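/- Let $\mathcal X$ be a measurable space and let a classifier be a measurable function $h:\mathcal X\to\{-1,+1\}$. For a probability measure $P$ on $\mathcal X$ and classifiers $h,f$ put $\mathrm{er}_P(h;f)=P(x:h(x)\ne f(x))$. Let $\mathbb C$ be a set of classifiers with $|\mathbb C|\ge 3$ and finite VC dimension $d$. A learning algorithm maps each finite sequence of points of $\mathcal X\times\{-1,+1\}$ (a data set) to a classifier. Call it $(\varepsilon,\delta)$-correct with $m$ examples if for every probability measure $P$ on $\mathcal X$ and every $f\in\mathbb C$, the classifier $\hat h$ that it returns on $(X_1,f(X_1)),\dots,(X_m,f(X_m))$, with $X_1,\dots,X_m$ independent and $P$-distributed, satisfies $\mathrm{er}_P(\hat h;f)\le\varepsilon$ with probability at least $1-\delta$. The sample complexity $\mathcal M(\varepsilon,\delta)$ is the least $m\ge 0$ for which some learning algorithm is $(\varepsilon,\delta)$-correct with $m$ examples ($\infty$ if there is none). Let $L$ be a sample-consistent learning algorithm: whenever some member of $\mathbb C$ agrees with all points of the data set $S$, $L(S)$ is such a member of $\mathbb C$. Suppose, as measurability convention, that for all $P$, all $f\in\mathbb C$ and all $n\ge 0$ the event that $L$,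 trained on $n$ independent $P$-distributed points labelled by $f$, errs on a further independent $P$-distributed point is measurable for the completed product measure. For data sets $S,T$, writing $\cup$ for concatenation of sequences, define a finite sequence $\mathbb A(S;T)$ of data sets recursively. If $|S|\le 3$, then $\mathbb A(S;T)$ is the one-term sequence $S\cup T$. Otherwise split $S$ into consecutive blocks $S_0,S_1,S_2,S_3$ of lengths $|S|-3\lfloor |S|/4\rfloor,\ \lfloor |S|/4\rfloor,\ \lfloor |S|/4\rfloor,\ \lfloor |S|/4\rfloor$ and put $$\mathbb A(S;T)=\mathbb A(S_0;S_2\cup S_3\cup T)\cup\mathbb A(S_0;S_1\cup S_3\cup T)\cup\mathbb A(S_0;S_1\cup S_2\cup T).$$ Let $\hat h_S=\mathrm{Maj}(L(\mathbb A(S;\emptyset)))$ be the pointwise majority vote (ties giving $+1$) of the classifiers obtained by applying $L$ to the data sets in $\mathbb A(S;\emptyset)$. Let $\mathrm{Log}(z)=\ln\max\{z,e\}$. Theorem. There is a numerical constant $c_0>0$, independent of $\mathcal X$, $\mathbb C$, $d$ and $L$, such that for all such $\mathcal X,\mathbb C,L$: 1. for all $\varepsilon,\delta\in(0,1)$, $\displaystyle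 \mathcal M(\varepsilon,\delta)\le \frac{c_0}{\varepsilon}\Big(d+\mathrm{Log}\frac1\delta\Big)$; 2. this is achieved by the algorithm $S\mapsto\hat h_S$: it is $(\varepsilon,\delta)$-correct with $m$ examples for all $\varepsilon,\delta\in(0,1)$ and all $m\ge\frac{c_0}{\varepsilon}(d+\mathrm{Log}\frac1\delta)$; 3. explicitly, for all $m\ge 0$, $\delta\in(0,1)$, all $P$ and all $f\in\mathbb C$, if $S$ consists of $m$ independent $P$-distributed points labelled by $f$, then with probability at least $1-\delta$ $$\mathrm{er}_P(\hat h_S;f)\le\frac{1800}{m+1}\Big(d+\ln\frac{18}{\delta}\Big).$$ -/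

import Mathlib

open MeasureTheory

namespace PACLearning

/-- A classifier on the instance space `X`: a measurable function into the label space
`{-1, +1}`, realised as the units `ℤˣ` of `ℤ`. -/
abbrev Classifier (X : Type*) [MeasurableSpace X] : Type _ :=
  {h : X → ℤˣ // Measurable h}

/-- A data set: a finite sequence of labelled points. -/
abbrev DataSet (X : Type*) : Type _ := List (X × ℤˣ)

/-- A (deterministic) learning algorithm: a map from data sets of any length to classifiers. -/
abbrev Learner (X : Type*) [MeasurableSpace X] : Type _ := DataSet X → Classifier X

section Basic

variable {X : Type*} [MeasurableSpace X]

/-- The data set `((x₁, f x₁), …, (xₘ, f xₘ))`. -/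
def label (f : Classifier X) {m : ℕ} (x : Fin m → X) : DataSet X :=
  List.ofFn (fun i => (x i, f.1 (x i)))

/-- The set `C[S]` of the members of `C` that are consistent with the data set `S`. -/
def consistentSet (C : Set (Classifier X)) (S : DataSet X) : Set (Classifier X) :=
  {h | h ∈ C ∧ ∀ z ∈ S, h.1 z.1 = z.2}

/-- The error rate `er_P(h; f) = P(x : h(x) ≠ f(x))`. -/
noncomputable def er (P : Measure X) (h f : Classifier X) : ℝ :=
  P.real {x | h.1 x ≠ f.1 x}

/-- The law of `m` independent `P`-distributed points. -/
noncomputable def iid (P : Measure X) (m : ℕ) : Measure (Fin m → X) :=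
  Measure.pi (fun _ => P)

/-- The sequence `x₁, …, x_k` is shattered by `C`. -/
def Shatters (C : Set (Classifier X)) {k : ℕ} (x : Fin k → X) : Prop :=
  ∀ y : Fin k → ℤˣ, ∃ h ∈ C, ∀ i, h.1 (x i) = y i

/-- The Vapnik-Chervonenkis dimension of `C` (`⊤` if arbitrarily long sequences are shattered). -/
noncomputable def vcDim (C : Set (Classifier X)) : ℕ∞ :=
  sSup {n : ℕ∞ | ∃ k : ℕ, n = k ∧ ∃ x : Fin k → X, Shatters C x}

/-- With `m` examples the learner `A` is `(ε, δ)`-correct for `C`: for all data distributions `P`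
and all targets `f ∈ C`, the trained classifier has error at most `ε` with probability at least
`1 - δ` (and this is an event of the completed probability space). -/
def IsPAC (C : Set (Classifier X)) (A : Learner X) (m : ℕ) (ε δ : ℝ) : Prop :=
  ∀ P : Measure X, IsProbabilityMeasure P → ∀ f ∈ C,
    NullMeasurableSet {x : Fin m → X | er P (A (label f x)) f ≤ ε} (iid P m) ∧
    1 - δ ≤ (iid P m).real {x : Fin m → X | er P (A (label f x)) f ≤ ε}

/-- The sample complexity of `(ε, δ)`-PAC learning `C`: the least `m` for which some learning
algorithm is `(ε, δ)`-correct with `m` examples, and `⊤` if there is none. -/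
noncomputable def sampleComplexity (C : Set (Classifier X)) (ε δ : ℝ) : ℕ∞ :=
  sInf {n : ℕ∞ | ∃ m : ℕ, n = m ∧ ∃ A : Learner X, IsPAC C A m ε δ}

/-- `L` is a sample-consistent learning algorithm for `C`: it returns an element of `C[S]`
whenever there is one. Its values on other data sets are irrelevant. -/
def IsConsistentLearner (C : Set (Classifier X)) (L : Learner X) : Prop :=
  ∀ S : DataSet X, (consistentSet C S).Nonempty → L S ∈ consistentSet C S

/-- Measurability convention for `L`: for all data distributions `P`, targets `f ∈ C` and `n`,
"`L`, trained on `n` independent examples, errs on an independent test point" is an event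
(of the completed probability space). -/
def HasMeasurableErrors (C : Set (Classifier X)) (L : Learner X) : Prop :=
  ∀ P : Measure X, IsProbabilityMeasure P → ∀ f ∈ C, ∀ n : ℕ,
    NullMeasurableSet
      {p : (Fin n → X) × X | (L (label f p.1)).1 p.2 ≠ f.1 p.2} ((iid P n).prod P)

end Basic

/-- The majority of a sequence of labels; ties are resolved as `+1`. -/
def majLabel (ys : List ℤˣ) : ℤˣ :=
  if 0 ≤ (ys.map (fun y : ℤˣ => (y : ℤ))).sum then 1 else -1

theorem measurable_sum_labels {X : Type*} [MeasurableSpace X] (hs : List (Classifier X)) :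
    Measurable (fun x => ((hs.map (fun h => h.1 x)).map (fun y : ℤˣ => (y : ℤ))).sum) := by
  induction hs with
  | nil => simp
  | cons h t ih =>
    simp only [List.map_cons, List.sum_cons]
    exact ((comap_measurable _).comp h.2).add ih

/-- The majority classifier of a sequence of classifiers. -/
def maj {X : Type*} [MeasurableSpace X] (hs : List (Classifier X)) : Classifier X :=
  ⟨fun x => majLabel (hs.map (fun h => h.1 x)),
    Measurable.ite (measurableSet_le measurable_const (measurable_sum_labels hs))
      measurable_const measurable_const⟩

/-- The recursive algorithm `𝔸(S; T)`, returning a finite sequence of subsamples of `S ∪ T`. -/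
def subsamples {α : Type*} (S T : List α) : List (List α) :=
  if S.length ≤ 3 then [S ++ T]
  else
    let q := S.length / 4
    let r := S.length - 3 * q
    let S₀ := S.take r
    let S₁ := (S.drop r).take q
    let S₂ := (S.drop (r + q)).take q
    let S₃ := S.drop (r + 2 * q)
    subsamples S₀ (S₂ ++ S₃ ++ T) ++ subsamples S₀ (S₁ ++ S₃ ++ T) ++
      subsamples S₀ (S₁ ++ S₂ ++ T)
termination_by S.length
decreasing_by all_goals (simp only [List.length_take]; omega)

/-- The learning algorithm `S ↦ Maj(L(𝔸(S; ∅)))`. -/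
def majLearner {X : Type*} [MeasurableSpace X] (L : Learner X) : Learner X :=
  fun S => maj ((subsamples S []).map L)

/-- The truncated logarithm `Log z = ln (max {z, e})`. -/
noncomputable def Log (z : ℝ) : ℝ := Real.log (max z (Real.exp 1))

end PACLearning

open PACLearning

/-! The engine is a localized uniform bound, `measure_exists_lt_measure_errSet_inter_le`. Let a
region E with P(E) ≤ p be independent of q sample points, and let finitely many members of `C` agree
with f on those points. For 0 < τ ≤ 1, the probability that one of them has error mass above η
inside E is at most (1+τp)^(2q) / ((1+η)^q τ^d). The number of sample points in E is never
conditioned on. A ghost sample is weighted by 2 to the number of its points in E where the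
classifier errs; for a fixed classifier this has mean (1 + P(E ∩ err))^q, so Markov's inequality
applies. Random swaps between the two samples bound the mean weight by the expected number of traces
on E (`sum_swap_weight_le`), and Sauer-Shelah in the form #traces · τ^d ≤ ∏ (1 + τ·1_E)
(`card_traces_mul_le`) integrates to a pure product.

The vote is handled by counting. When the majority of three equal groups errs at a point, the
majority of one group errs there together with at least a quarter of the other two groups; averaging
costs a factor 12 (`measure_errSet_maj_append_le`). The i-th group never sees block S_i, while every
classifier of the other two groups is trained on it. Hence the localized bound applies with E the
error region of the i-th majority, whose size is controlled by induction. That size is already of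
order (d + log(1/δ))/m, so about d + log(1/δ) points of the block are expected in E and no factor
log(m/d) is lost: η comes out of the same order. `errBound_recursion` checks that the constants
reproduce themselves, and `measure_errBound_lt_le` runs the induction with six bad events of
probability at most δ/6 each. -/

open scoped ENNReal

namespace PACLearning

/-! ### Sauer-Shelah and random swaps, in weighted form. -/

section Combinatorics

open Classical in
/-- The traces on the labelled points `w` of the sets `E ∩ {h ≠ f}`, for `h ∈ C`. -/
noncomputable def traces {X K : Type*} [MeasurableSpace X] [Fintype K] (C : Set (Classifier X))
    (f : Classifier X) (E : Set X) (w : K → X) : Finset (Finset K) :=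
  Finset.univ.filter fun D => ∃ h ∈ C,
    D = Finset.univ.filter fun k => w k ∈ E ∧ h.1 (w k) ≠ f.1 (w k)

theorem units_int_eq_of_ne {a b c : ℤˣ} (hab : a ≠ c) (hbc : b ≠ c) : a = b := by
  rcases Int.units_eq_one_or a with rfl | rfl <;> rcases Int.units_eq_one_or b with rfl | rfl <;>
    rcases Int.units_eq_one_or c with rfl | rfl <;> simp_all

theorem card_le_of_shatters {X : Type*} [MeasurableSpace X] {C : Set (Classifier X)} {d k : ℕ}
    (hd : vcDim C ≤ d) {x : Fin k → X} (hx : Shatters C x) : k ≤ d := by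
  have h : (k : ℕ∞) ≤ vcDim C := le_sSup ⟨k, rfl, x, hx⟩
  exact_mod_cast h.trans hd

open Classical in
/-- The Sauer-Shelah bound, in a weighted form. -/
theorem card_traces_mul_le {X K : Type*} [MeasurableSpace X] [Fintype K]
    {C : Set (Classifier X)} {d : ℕ} (hd : vcDim C ≤ d) (f : Classifier X) (E : Set X) (w : K → X)
    {τ : ℝ≥0∞} (hτ : τ ≤ 1) :
    ((traces C f E w).card : ℝ≥0∞) * τ ^ d ≤ ∏ k, (1 + E.indicator (fun _ => τ) (w k)) := by
  set F : Finset K := Finset.univ.filter fun k => w k ∈ E with hF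
  -- A set shattered by the traces lies in E, since it is itself a trace on itself. It is also
  -- shattered by `C`: prescribing labels amounts to prescribing where h differs from f, as there
  -- are only two labels.
  have hsub : (traces C f E w).shatterer ⊆ F.powerset.filter fun s => s.card ≤ d := by
    intro s hs
    rw [Finset.mem_shatterer] at hs
    have htr : ∀ t ⊆ s, ∃ h ∈ C,
        s ∩ (Finset.univ.filter fun k => w k ∈ E ∧ h.1 (w k) ≠ f.1 (w k)) = t := by
      intro t ht
      obtain ⟨u, hu, hut⟩ := hs ht
      obtain ⟨h, hC, rfl⟩ := (Finset.mem_filter.1 hu).2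
      exact ⟨h, hC, hut⟩
    have hsF : s ⊆ F := by
      obtain ⟨h, -, hh⟩ := htr s subset_rfl
      intro k hk
      rw [← hh] at hk
      have := (Finset.mem_filter.1 (Finset.mem_inter.1 hk).2).2
      simp [hF, this.1]
    refine Finset.mem_filter.2 ⟨Finset.mem_powerset.2 hsF, ?_⟩
    refine card_le_of_shatters (C := C) hd (x := fun i => w (s.equivFin.symm i)) ?_
    intro y
    obtain ⟨h, hC, hh⟩ := htr (s.filter fun k => ∃ hk : k ∈ s, y (s.equivFin ⟨k, hk⟩) ≠ f.1 (w k))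
      (Finset.filter_subset _ _)
    refine ⟨h, hC, fun i => ?_⟩
    have hmem := (s.equivFin.symm i).2
    have hE : w (s.equivFin.symm i) ∈ E := by
      have := hsF hmem
      simpa [hF] using this
    have := Finset.ext_iff.1 hh (s.equivFin.symm i)
    simp only [Finset.mem_inter, Finset.mem_filter, Finset.mem_univ, true_and, hmem, hE,
      exists_true_left, Subtype.coe_eta, Equiv.apply_symm_apply] at this
    by_cases hy : y i = f.1 (w (s.equivFin.symm i))
    · rw [hy]
      by_contra hne
      exact this.1 hne hy
    · exact units_int_eq_of_ne (this.2 hy) hy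
  have hcard : (traces C f E w).card ≤ (F.powerset.filter fun s => s.card ≤ d).card :=
    (Finset.card_le_card_shatterer _).trans (Finset.card_le_card hsub)
  calc ((traces C f E w).card : ℝ≥0∞) * τ ^ d
      ≤ ((F.powerset.filter fun s => s.card ≤ d).card : ℝ≥0∞) * τ ^ d := by gcongr
    _ = ∑ s ∈ F.powerset.filter fun s => s.card ≤ d, τ ^ d := by simp
    _ ≤ ∑ s ∈ F.powerset.filter fun s => s.card ≤ d, τ ^ s.card := by
        refine Finset.sum_le_sum fun s hs => ?_
        exact pow_le_pow_right_of_le_one' hτ (Finset.mem_filter.1 hs).2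
    _ ≤ ∑ s ∈ F.powerset, τ ^ s.card :=
        Finset.sum_le_sum_of_subset (Finset.filter_subset _ _)
    _ = ∏ k ∈ F, (1 + τ) := by rw [Finset.prod_one_add]; simp
    _ = ∏ k, (1 + E.indicator (fun _ => τ) (w k)) := by
        rw [hF, Finset.prod_filter]
        refine Finset.prod_congr rfl fun k _ => ?_
        rw [Set.indicator_apply]
        split_ifs <;> simp

open Classical in
/-- A fixed set of marked points avoids the first half of a randomly swapped double sample with
small probability, in a form weighted by its intersection with the second half. -/
theorem sum_swap_weight_le {J : Type*} [Fintype J] (D : Finset (J × Bool)) :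
    ∑ σ : J → Bool, ∏ j, (if (j, σ j) ∈ D then (0 : ℝ≥0∞)
      else 1 + if (j, !σ j) ∈ D then 1 else 0) ≤ 2 ^ Fintype.card J := by
  have h := Finset.prod_univ_sum (fun _ : J => (Finset.univ : Finset Bool))
    (fun j b => if (j, b) ∈ D then (0 : ℝ≥0∞) else 1 + if (j, !b) ∈ D then 1 else 0)
  rw [Fintype.piFinset_univ] at h
  rw [← h, ← Finset.card_univ, ← Finset.prod_const]
  -- The swaps are independent, so it suffices to bound each pair by 2: both points marked gives 0 +
  -- 0, exactly one gives 0 + 2, none gives 1 + 1.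
  refine Finset.prod_le_prod' fun j _ => ?_
  rw [Fintype.sum_bool]
  by_cases h1 : (j, true) ∈ D <;> by_cases h2 : (j, false) ∈ D <;> simp [h1, h2, one_add_one_eq_two]

end Combinatorics

theorem lintegral_prod_pi {J Y : Type*} [Fintype J] [MeasurableSpace Y] (P : Measure Y)
    [IsProbabilityMeasure P] {φ : Y → ℝ≥0∞} (hφ : Measurable φ) :
    ∫⁻ u : J → Y, ∏ j, φ (u j) ∂Measure.pi (fun _ => P) = (∫⁻ y, φ y ∂P) ^ Fintype.card J := by
  have hind := ProbabilityTheory.iIndepFun_pi (μ := fun _ : J => P) (X := fun _ => φ)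
    (fun _ => hφ.aemeasurable)
  have := ProbabilityTheory.lintegral_prod_eq_prod_lintegral_of_indepFun Finset.univ
    (fun (j : J) (u : J → Y) => φ (u j)) hind (fun j => hφ.comp (measurable_pi_apply j))
  rw [this, Finset.prod_congr rfl (fun j _ =>
    (measurePreserving_eval (fun _ : J => P) j).lintegral_comp hφ)]
  simp

/-- The region where `h` disagrees with `f`. -/
def errSet {X : Type*} [MeasurableSpace X] (h f : Classifier X) : Set X :=
  {t | h.1 t ≠ f.1 t}

theorem measurableSet_errSet {X : Type*} [MeasurableSpace X] (h f : Classifier X) :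
    MeasurableSet (errSet h f) :=
  ((MeasurableSet.congr (measurableSet_eq_fun ((comap_measurable Units.val).comp h.2)
    ((comap_measurable Units.val).comp f.2)) (by ext t; simp [Units.ext_iff])) :
    MeasurableSet {t | h.1 t = f.1 t}).compl

/-! ### Ghost samples and the localized uniform bound for a fixed region. -/

section DoubleSample

variable {X J κ : Type*} [MeasurableSpace X] [Fintype J]

/-- The largest weight `2 ^ #{j | v j ∈ E ∩ {H k u ≠ f}}` of a ghost sample `v`. -/
noncomputable def ghostWeight (f : Classifier X) (E : Set X) (H : κ → (J → X) → Classifier X)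
    (u v : J → X) : ℝ≥0∞ :=
  ⨆ k, ∏ j, (1 + (E ∩ errSet (H k u) f).indicator (fun _ => 1) (v j))

theorem aemeasurable_ghostWeight [Countable κ] {P : Measure X} [IsProbabilityMeasure P]
    {f : Classifier X} {E : Set X} (hE : MeasurableSet E) {H : κ → (J → X) → Classifier X}
    (hH : ∀ k, NullMeasurableSet {p : (J → X) × X | (H k p.1).1 p.2 ≠ f.1 p.2}
      ((Measure.pi fun _ => P).prod P)) :
    AEMeasurable (fun p : (J → X) × (J → X) => ghostWeight f E H p.1 p.2)
      ((Measure.pi fun _ => P).prod (Measure.pi fun _ => P)) := by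
  refine AEMeasurable.iSup fun k => ?_
  refine Finset.aemeasurable_fun_prod _ fun j _ => ?_
  refine AEMeasurable.const_add ?_ _
  have hqm : Measure.QuasiMeasurePreserving (fun p : (J → X) × (J → X) => (p.1, p.2 j))
      ((Measure.pi fun _ => P).prod (Measure.pi fun _ => P)) ((Measure.pi fun _ => P).prod P) :=
    ((MeasurePreserving.id _).prod (measurePreserving_eval (fun _ : J => P) j)).quasiMeasurePreserving
  have hset : NullMeasurableSet {p : (J → X) × (J → X) | p.2 j ∈ E ∩ errSet (H k p.1) f}
      ((Measure.pi fun _ => P).prod (Measure.pi fun _ => P)) :=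
    ((measurable_snd hE).nullMeasurableSet.inter (hH k)).preimage hqm
  have := (aemeasurable_const (b := (1 : ℝ≥0∞))).indicator₀ hset
  refine this.congr (Filter.Eventually.of_forall fun p => ?_)
  rfl

/-- Swapping the points of a double sample at the indices selected by `σ`. -/
def swapAt (σ : J → Bool) (v : J → X × X) : J → X × X :=
  fun j => if σ j then (v j).swap else v j

theorem measurePreserving_swapAt (P : Measure X) [IsProbabilityMeasure P] (σ : J → Bool) :
    MeasurePreserving (swapAt σ : (J → X × X) → (J → X × X))
      (Measure.pi fun _ => P.prod P) (Measure.pi fun _ => P.prod P) := by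
  refine measurePreserving_pi (f := fun j (z : X × X) => if σ j then z.swap else z)
    (fun _ => P.prod P) (fun _ => P.prod P) fun j => ?_
  cases σ j
  · exact MeasurePreserving.id _
  · exact Measure.measurePreserving_swap

-- A supremum over classifiers is at most a sum over the traces they leave on the unordered double
-- sample. That set of traces does not depend on σ, so the sums can be exchanged and each trace
-- averaged separately.
open Classical in
theorem sum_ghostWeight_swapAt_le {C : Set (Classifier X)} {f : Classifier X} {E : Set X}
    {H : κ → (J → X) → Classifier X} (hC : ∀ k u, H k u ∈ C)
    (hcons : ∀ k u j, (H k u).1 (u j) = f.1 (u j)) (v : J → X × X) :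
    ∑ σ : J → Bool, ghostWeight f E H (fun j => (swapAt σ v j).1) (fun j => (swapAt σ v j).2)
      ≤ (traces C f E fun p : J × Bool => if p.2 then (v p.1).2 else (v p.1).1).card
        * 2 ^ Fintype.card J := by
  set w : J × Bool → X := fun p => if p.2 then (v p.1).2 else (v p.1).1 with hw
  have h1 : ∀ (σ : J → Bool) j, (swapAt σ v j).1 = w (j, σ j) := by
    intro σ j; simp only [swapAt, hw]; cases σ j <;> simp
  have h2 : ∀ (σ : J → Bool) j, (swapAt σ v j).2 = w (j, !σ j) := by
    intro σ j; simp only [swapAt, hw]; cases σ j <;> simp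
  calc ∑ σ : J → Bool, ghostWeight f E H (fun j => (swapAt σ v j).1) (fun j => (swapAt σ v j).2)
      ≤ ∑ σ : J → Bool, ∑ D ∈ traces C f E w, ∏ j, (if (j, σ j) ∈ D then (0 : ℝ≥0∞)
          else 1 + if (j, !σ j) ∈ D then 1 else 0) := by
        refine Finset.sum_le_sum fun σ _ => iSup_le fun k => ?_
        set h := H k (fun j => (swapAt σ v j).1) with hh
        have hmem : (Finset.univ.filter fun p => w p ∈ E ∧ h.1 (w p) ≠ f.1 (w p))
            ∈ traces C f E w :=
          Finset.mem_filter.2 ⟨Finset.mem_univ _, h, hC _ _, rfl⟩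
        refine le_trans ?_ (Finset.single_le_sum (fun _ _ => zero_le) hmem)
        refine (Finset.prod_congr rfl fun j _ => ?_).le
        -- Consistency on the first half keeps its points out of the trace, so the factor 0 never
        -- occurs for this trace and the product is exactly the ghost weight.
        have hj : h.1 (w (j, σ j)) = f.1 (w (j, σ j)) := by
          rw [← h1]; exact hcons k _ j
        simp only [Finset.mem_filter, Finset.mem_univ, true_and, hj, ne_eq, not_true_eq_false,
          and_false, if_false, h2, Set.indicator_apply, Set.mem_inter_iff, errSet, Set.mem_ofPred_eq]
    _ = ∑ D ∈ traces C f E w, ∑ σ : J → Bool, ∏ j, (if (j, σ j) ∈ D then (0 : ℝ≥0∞)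
          else 1 + if (j, !σ j) ∈ D then 1 else 0) := Finset.sum_comm
    _ ≤ ∑ D ∈ traces C f E w, 2 ^ Fintype.card J :=
        Finset.sum_le_sum fun D _ => sum_swap_weight_le D
    _ = _ := by simp

theorem lintegral_one_add_indicator (P : Measure X) [IsProbabilityMeasure P] {A : Set X}
    (hA : MeasurableSet A) (τ : ℝ≥0∞) :
    ∫⁻ t, (1 + A.indicator (fun _ => τ) t) ∂P = 1 + τ * P A := by
  rw [lintegral_add_left measurable_const, lintegral_indicator_const hA]
  simp

theorem measurable_one_add_indicator {A : Set X} (hA : MeasurableSet A)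
    (τ : ℝ≥0∞) : Measurable fun t => 1 + A.indicator (fun _ => τ) t :=
  Measurable.const_add (measurable_const.indicator hA) 1

/-- Averaging over the random swaps of a double sample. -/
theorem lintegral_le_of_sum_swapAt_le [DecidableEq J] {P : Measure X} [IsProbabilityMeasure P]
    {G Φ : (J → X × X) → ℝ≥0∞} (hG : AEMeasurable G (Measure.pi fun _ => P.prod P))
    (h : ∀ v, ∑ σ : J → Bool, G (swapAt σ v) ≤ 2 ^ Fintype.card J * Φ v) :
    ∫⁻ v, G v ∂(Measure.pi fun _ => P.prod P) ≤ ∫⁻ v, Φ v ∂(Measure.pi fun _ => P.prod P) := by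
  set ν := Measure.pi fun _ : J => P.prod P with hν
  have hσ : ∀ σ : J → Bool, MeasurePreserving (swapAt σ) ν ν := measurePreserving_swapAt P
  have hswap : ∀ σ : J → Bool, ∫⁻ v, G (swapAt σ v) ∂ν = ∫⁻ v, G v ∂ν := by
    intro σ
    rw [← lintegral_map' (by rw [(hσ σ).map_eq]; exact hG) (hσ σ).measurable.aemeasurable,
      (hσ σ).map_eq]
  have key : 2 ^ Fintype.card J * ∫⁻ v, G v ∂ν ≤ 2 ^ Fintype.card J * ∫⁻ v, Φ v ∂ν := by
    calc 2 ^ Fintype.card J * ∫⁻ v, G v ∂ν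
        = ∑ σ : J → Bool, ∫⁻ v, G (swapAt σ v) ∂ν := by
          rw [Finset.sum_congr rfl fun σ _ => hswap σ, Finset.sum_const, Finset.card_univ,
            Fintype.card_fun, Fintype.card_bool, nsmul_eq_mul]
          push_cast
          rfl
      _ = ∫⁻ v, ∑ σ : J → Bool, G (swapAt σ v) ∂ν := by
          rw [lintegral_finsetSum']
          exact fun σ _ => hG.comp_quasiMeasurePreserving (hσ σ).quasiMeasurePreserving
      _ ≤ ∫⁻ v, 2 ^ Fintype.card J * Φ v ∂ν := lintegral_mono h
      _ = 2 ^ Fintype.card J * ∫⁻ v, Φ v ∂ν :=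
          lintegral_const_mul' _ _ (ENNReal.pow_ne_top ENNReal.ofNat_ne_top)
  exact (ENNReal.mul_le_mul_iff_right (by simp) (ENNReal.pow_ne_top ENNReal.ofNat_ne_top)).1 key

/-- After the swaps only the number of traces on 2|J| independent points remains. The weighted
Sauer-Shelah bound majorizes it by a product over the points, whose mean factorizes. -/
theorem lintegral_ghostWeight_mul_le [Countable κ] {P : Measure X} [IsProbabilityMeasure P]
    {C : Set (Classifier X)} {d : ℕ} (hd : vcDim C ≤ d)
    {f : Classifier X} {E : Set X} (hE : MeasurableSet E) {H : κ → (J → X) → Classifier X}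
    (hC : ∀ k u, H k u ∈ C) (hcons : ∀ k u j, (H k u).1 (u j) = f.1 (u j))
    (hH : ∀ k, NullMeasurableSet {p : (J → X) × X | (H k p.1).1 p.2 ≠ f.1 p.2}
      ((Measure.pi fun _ => P).prod P)) {τ : ℝ≥0∞} (hτ : τ ≤ 1) :
    (∫⁻ p, ghostWeight f E H p.1 p.2 ∂((Measure.pi fun _ => P).prod (Measure.pi fun _ => P)))
      * τ ^ d ≤ (1 + τ * P E) ^ (2 * Fintype.card J) := by
  classical
  have hmp := measurePreserving_arrowProdEquivProdArrow X X J (fun _ => P) (fun _ => P)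
  have hG := (aemeasurable_ghostWeight hE hH).comp_quasiMeasurePreserving hmp.quasiMeasurePreserving
  have hφ := ((measurable_one_add_indicator hE τ).comp measurable_fst).mul
      ((measurable_one_add_indicator hE τ).comp measurable_snd)
  have hτd : τ ^ d ≠ ∞ := ENNReal.pow_ne_top (ne_top_of_le_ne_top ENNReal.one_ne_top hτ)
  calc _ = (∫⁻ v : J → X × X, ghostWeight f E H (fun j => (v j).1) (fun j => (v j).2)
        ∂Measure.pi fun _ => P.prod P) * τ ^ d := by
        congr 1
        exact (hmp.lintegral_comp_emb (MeasurableEquiv.measurableEmbedding _) _).symm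
    _ = ∫⁻ v : J → X × X, ghostWeight f E H (fun j => (v j).1) (fun j => (v j).2) * τ ^ d
        ∂Measure.pi fun _ => P.prod P := by rw [lintegral_mul_const' _ _ hτd]
    _ ≤ ∫⁻ v : J → X × X, ∏ j, ((1 + E.indicator (fun _ => τ) (v j).1) *
            (1 + E.indicator (fun _ => τ) (v j).2)) ∂Measure.pi fun _ => P.prod P := by
        refine lintegral_le_of_sum_swapAt_le (hG.mul_const _) fun v => ?_
        rw [← Finset.sum_mul]
        refine (mul_le_mul_left (sum_ghostWeight_swapAt_le (E := E) hC hcons v) _).trans ?_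
        rw [mul_comm (Nat.cast _), mul_assoc]
        refine mul_le_mul_right ((card_traces_mul_le hd f E _ hτ).trans ?_) _
        rw [Fintype.prod_prod_type]
        refine (Finset.prod_congr rfl fun j _ => ?_).le
        rw [Fintype.prod_bool, mul_comm]
        simp
    _ = (1 + τ * P E) ^ (2 * Fintype.card J) := by
        refine (lintegral_prod_pi (P.prod P) hφ).trans ?_
        refine (congrArg (· ^ Fintype.card J) (lintegral_prod_mul
          (measurable_one_add_indicator hE τ).aemeasurable
          (measurable_one_add_indicator hE τ).aemeasurable)).trans ?_
        rw [lintegral_one_add_indicator P hE, ← sq, ← pow_mul]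

/-- If `H` returns members of `C` that are consistent with `f` on the sample, then with high
probability all of them have small error inside a fixed region `E`; the bound improves with the
probability of `E`. -/
theorem measure_exists_lt_measure_inter_errSet_le [Finite κ] {P : Measure X}
    [IsProbabilityMeasure P] {C : Set (Classifier X)} {d : ℕ} (hd : vcDim C ≤ d)
    {f : Classifier X} {E : Set X} (hE : MeasurableSet E) {H : κ → (J → X) → Classifier X}
    (hC : ∀ k u, H k u ∈ C) (hcons : ∀ k u j, (H k u).1 (u j) = f.1 (u j))
    (hH : ∀ k, NullMeasurableSet {p : (J → X) × X | (H k p.1).1 p.2 ≠ f.1 p.2}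
      ((Measure.pi fun _ => P).prod P)) {τ : ℝ≥0∞} (hτ : τ ≤ 1) (η : ℝ≥0∞) :
    (1 + η) ^ Fintype.card J * (Measure.pi fun _ => P) {u | ∃ k, η < P (E ∩ errSet (H k u) f)}
      * τ ^ d ≤ (1 + τ * P E) ^ (2 * Fintype.card J) := by
  refine le_trans ?_ (lintegral_ghostWeight_mul_le hd hE hC hcons hH hτ)
  have hG := aemeasurable_ghostWeight hE hH
  rw [lintegral_prod _ hG]
  gcongr
  -- Markov's inequality for the ghost weight averaged over v: on the bad event a single bad k
  -- already makes this average at least (1 + η)^|J|.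
  refine le_trans ?_ (mul_meas_ge_le_lintegral₀ hG.lintegral_prod_right'
    ((1 + η) ^ Fintype.card J))
  gcongr with u
  rintro ⟨k, hk⟩
  have hA : MeasurableSet (E ∩ errSet (H k u) f) := hE.inter (measurableSet_errSet _ _)
  calc (1 + η) ^ Fintype.card J
      ≤ (1 + 1 * P (E ∩ errSet (H k u) f)) ^ Fintype.card J := by rw [one_mul]; gcongr
    _ = ∫⁻ v : J → X, ∏ j, (1 + (E ∩ errSet (H k u) f).indicator (fun _ => 1) (v j))
          ∂Measure.pi fun _ => P := by
        rw [← lintegral_one_add_indicator P hA,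
          lintegral_prod_pi P (φ := fun t => 1 + (E ∩ errSet (H k u) f).indicator (fun _ => 1) t)
            (measurable_one_add_indicator hA 1)]
    _ ≤ ∫⁻ v, ghostWeight f E H u v ∂Measure.pi fun _ => P :=
        lintegral_mono fun v => le_iSup
          (fun k => ∏ j, (1 + (E ∩ errSet (H k u) f).indicator (fun _ => (1 : ℝ≥0∞)) (v j))) k

end DoubleSample

/-! ### Fubini for sets measurable only in the completed product. -/

section Sections

variable {Ω Y : Type*} [MeasurableSpace Ω] [MeasurableSpace Y] {μ : Measure Ω} {ν : Measure Y}

theorem aemeasurable_measure_section [SFinite ν] {N : Set (Ω × Y)}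
    (hN : NullMeasurableSet N (μ.prod ν)) :
    AEMeasurable (fun x => ν (Prod.mk x ⁻¹' N)) μ := by
  obtain ⟨t, ht, hNt⟩ := hN
  refine ⟨fun x => ν (Prod.mk x ⁻¹' t), measurable_measure_prodMk_left ht, ?_⟩
  filter_upwards [Measure.ae_ae_of_ae_prod hNt] with x hx
  exact measure_congr hx

theorem ae_nullMeasurableSet_section [SFinite ν] {N : Set (Ω × Y)}
    (hN : NullMeasurableSet N (μ.prod ν)) :
    ∀ᵐ x ∂μ, NullMeasurableSet (Prod.mk x ⁻¹' N) ν := by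
  obtain ⟨t, ht, hNt⟩ := hN
  filter_upwards [Measure.ae_ae_of_ae_prod hNt] with x hx
  exact ⟨_, measurable_prodMk_left ht, hx⟩

theorem mul_measure_prod_le [IsProbabilityMeasure μ] [SFinite ν] {N : Set (Ω × Y)}
    (hN : NullMeasurableSet N (μ.prod ν)) {K r : ℝ≥0∞}
    (h : ∀ᵐ x ∂μ, K * ν (Prod.mk x ⁻¹' N) ≤ r) : K * μ.prod ν N ≤ r := by
  obtain ⟨t, ht, hNt⟩ := hN
  rw [measure_congr hNt, Measure.prod_apply ht,
    ← lintegral_const_mul _ (measurable_measure_prodMk_left ht)]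
  calc ∫⁻ x, K * ν (Prod.mk x ⁻¹' t) ∂μ ≤ ∫⁻ _, r ∂μ := by
        refine lintegral_mono_ae ?_
        filter_upwards [h, Measure.ae_ae_of_ae_prod hNt] with x hx hxt
        have : ν (Prod.mk x ⁻¹' t) = ν (Prod.mk x ⁻¹' N) := (measure_congr hxt).symm
        rwa [this]
    _ = r := by simp

end Sections

/-- Coordinates at distinct indices are again independent: a box pulls back to a box whose sides are
the whole space off the range of e. This carries the measurability convention from n examples to any
n distinct sample indices. -/
theorem measurePreserving_comp_injective {ι κ X : Type*} [Fintype ι] [Fintype κ]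
    [MeasurableSpace X] (P : Measure X) [IsProbabilityMeasure P] {e : κ → ι}
    (he : Function.Injective e) :
    MeasurePreserving (fun (x : ι → X) k => x (e k)) (Measure.pi fun _ => P)
      (Measure.pi fun _ => P) := by
  classical
  have hm : Measurable fun (x : ι → X) k => x (e k) :=
    measurable_pi_lambda _ fun k => measurable_pi_apply _
  refine ⟨hm, (Measure.pi_eq fun s hs => ?_).symm⟩
  rw [Measure.map_apply hm (MeasurableSet.univ_pi hs)]
  have hset : (fun (x : ι → X) k => x (e k)) ⁻¹' Set.univ.pi s
      = Set.univ.pi fun i => ⋂ k, ⋂ (_ : e k = i), s k := by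
    ext x
    simp only [Set.mem_preimage, Set.mem_univ_pi, Set.mem_iInter]
    exact ⟨fun h i k hk => hk ▸ h k, fun h k => h _ k rfl⟩
  rw [hset, Measure.pi_pi]
  symm
  refine Finset.prod_of_injOn e he.injOn (by simp) ?_ ?_
  · intro i _ hi
    have : (⋂ k, ⋂ (_ : e k = i), s k) = Set.univ := by
      refine Set.eq_univ_of_forall fun t => Set.mem_iInter₂.2 fun k hk => ?_
      exact absurd ⟨k, by simp, hk⟩ hi
    rw [this, measure_univ]
  · intro k _
    congr 1
    ext t
    simp only [Set.mem_iInter]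
    exact ⟨fun h k' hk' => he hk' ▸ h, fun h => h k rfl⟩

/-! ### Random classifiers with measurable errors. -/

section ErrNullMeasurable

variable {Ω X : Type*} [MeasurableSpace Ω] [MeasurableSpace X]

/-- The random classifier `g` errs on an independent test point with a well-defined probability. -/
def ErrNullMeasurable (μ : Measure Ω) (P : Measure X) (f : Classifier X) (g : Ω → Classifier X) :
    Prop :=
  NullMeasurableSet {p : Ω × X | (g p.1).1 p.2 ≠ f.1 p.2} (μ.prod P)

theorem ErrNullMeasurable.aemeasurable_measure_errSet {μ : Measure Ω} {P : Measure X} [SFinite P]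
    {f : Classifier X} {g : Ω → Classifier X} (hg : ErrNullMeasurable μ P f g) :
    AEMeasurable (fun x => P (errSet (g x) f)) μ :=
  aemeasurable_measure_section hg

theorem ErrNullMeasurable.aemeasurable_measure_inter_errSet {μ : Measure Ω} {P : Measure X}
    [SFinite P] {f : Classifier X} {g h : Ω → Classifier X} (hg : ErrNullMeasurable μ P f g)
    (hh : ErrNullMeasurable μ P f h) :
    AEMeasurable (fun x => P (errSet (g x) f ∩ errSet (h x) f)) μ :=
  aemeasurable_measure_section (NullMeasurableSet.inter hg hh)

theorem ErrNullMeasurable.comp_measurePreserving {Ω' : Type*} [MeasurableSpace Ω']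
    {μ : Measure Ω} {μ' : Measure Ω'} [SFinite μ] [SFinite μ'] {P : Measure X} [SFinite P]
    {f : Classifier X} {g : Ω → Classifier X} (hg : ErrNullMeasurable μ P f g) {e : Ω' → Ω}
    (he : MeasurePreserving e μ' μ) : ErrNullMeasurable μ' P f fun y => g (e y) :=
  NullMeasurableSet.preimage hg (he.prod (MeasurePreserving.id P)).quasiMeasurePreserving

end ErrNullMeasurable

/-! ### From a fixed region to one that depends on the remaining sample points. -/

section Transfer

variable {ι κ X : Type*} [Fintype ι] [MeasurableSpace X]

/-- The localized uniform error bound for a region determined by the sample points outside `J` and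
classifiers in `C` that are consistent on the sample points in `J`. -/
theorem measure_exists_lt_measure_errSet_inter_le [Finite κ] {P : Measure X}
    [IsProbabilityMeasure P] {C : Set (Classifier X)} {d : ℕ} (hd : vcDim C ≤ d)
    {f : Classifier X} (J : Finset ι) {g : (ι → X) → Classifier X}
    (hgJ : ∀ x y, (∀ i ∉ J, x i = y i) → g x = g y)
    (hg : ErrNullMeasurable (Measure.pi fun _ => P) P f g)
    {H : κ → (ι → X) → Classifier X} (hC : ∀ k x, H k x ∈ C)
    (hcons : ∀ k x, ∀ i ∈ J, (H k x).1 (x i) = f.1 (x i))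
    (hH : ∀ k, ErrNullMeasurable (Measure.pi fun _ => P) P f (H k))
    {τ : ℝ≥0∞} (hτ : τ ≤ 1) (p η : ℝ≥0∞) :
    ((1 + η) ^ J.card * τ ^ d) * (Measure.pi fun _ => P)
      {x | P (errSet (g x) f) ≤ p ∧ ∃ k, η < P (errSet (g x) f ∩ errSet (H k x) f)}
      ≤ (1 + τ * p) ^ (2 * J.card) := by
  classical
  set B := {x | P (errSet (g x) f) ≤ p ∧ ∃ k, η < P (errSet (g x) f ∩ errSet (H k x) f)} with hBdef
  have hB : NullMeasurableSet B (Measure.pi fun _ => P) := by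
    have : {x | ∃ k, η < P (errSet (g x) f ∩ errSet (H k x) f)}
        = ⋃ k, {x | η < P (errSet (g x) f ∩ errSet (H k x) f)} := by ext; simp
    have hU : NullMeasurableSet {x | ∃ k, η < P (errSet (g x) f ∩ errSet (H k x) f)}
        (Measure.pi fun _ => P) := by
      rw [this]
      exact NullMeasurableSet.iUnion fun k =>
        nullMeasurableSet_lt aemeasurable_const (hg.aemeasurable_measure_inter_errSet (hH k))
    exact (nullMeasurableSet_le hg.aemeasurable_measure_errSet aemeasurable_const).inter hU
  have he := (measurePreserving_piEquivPiSubtypeProd (fun _ : ι => P) (· ∉ J)).symm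
  set e := (MeasurableEquiv.piEquivPiSubtypeProd (fun _ : ι => X) (· ∉ J)).symm with hedef
  have heJ : ∀ y u (j : {i // ¬ i ∉ J}), e (y, u) j = u j := by
    intro y u j
    simp only [hedef, MeasurableEquiv.piEquivPiSubtypeProd, MeasurableEquiv.coe_mk,
      MeasurableEquiv.symm_mk, Equiv.piEquivPiSubtypeProd, Equiv.coe_fn_symm_mk]
    rw [dif_neg j.2]
  have heC : ∀ y u u' i, i ∉ J → e (y, u) i = e (y, u') i := by
    intro y u u' i hi
    simp [hedef, MeasurableEquiv.piEquivPiSubtypeProd, Equiv.piEquivPiSubtypeProd, hi]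
  have hcard : Fintype.card {i // ¬ i ∉ J} = J.card := Fintype.card_of_subtype J (by simp)
  rw [← he.measure_preimage hB]
  refine mul_measure_prod_le (hB.preimage he.quasiMeasurePreserving) ?_
  -- Null measurability passes only to almost every section, which suffices for integrating over y.
  have hsec : ∀ k, ∀ᵐ y ∂(Measure.pi fun _ : {i // i ∉ J} => P),
      ErrNullMeasurable (Measure.pi fun _ : {i // ¬ i ∉ J} => P) P f fun u => H k (e (y, u)) := by
    intro k
    exact ae_nullMeasurableSet_section
      (NullMeasurableSet.preimage ((hH k).comp_measurePreserving he)
        ((measurePreserving_prodAssoc _ _ P).symm).quasiMeasurePreserving)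
  filter_upwards [ae_all_iff.2 hsec] with y hy
  have : Nonempty X := P.nonempty_of_neZero
  set u₀ : {i // ¬ i ∉ J} → X := fun _ => Classical.arbitrary X
  -- Once the points outside J are frozen, the region is a fixed set, independent of the points in
  -- J.
  have hgy : ∀ u, g (e (y, u)) = g (e (y, u₀)) := fun u => hgJ _ _ fun i hi => heC y u u₀ i hi
  by_cases hp : P (errSet (g (e (y, u₀))) f) ≤ p
  · have core := measure_exists_lt_measure_inter_errSet_le hd
      (measurableSet_errSet (g (e (y, u₀))) f)
      (H := fun k u => H k (e (y, u))) (fun k u => hC _ _)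
      (fun k u j => by
        have := hcons k (e (y, u)) j (not_not.1 j.2)
        rwa [heJ] at this) hy hτ η
    rw [hcard, mul_right_comm] at core
    refine le_trans (mul_le_mul_right (measure_mono ?_) _) (core.trans ?_)
    · rintro u ⟨-, k, hk⟩
      refine ⟨k, ?_⟩
      rw [← hgy u]
      exact hk
    · gcongr
  · have : Prod.mk y ⁻¹' (e ⁻¹' B) = ∅ := by
      refine Set.eq_empty_of_forall_notMem fun u hu => hp ?_
      rw [← hgy u]
      exact hu.1
    rw [this]
    simp

end Transfer

/-! ### Structure of the recursive subsamples. -/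

section Subsamples

variable {α β : Type*}

theorem subsamples_of_length_le {S : List α} (T : List α) (h : S.length ≤ 3) :
    subsamples S T = [S ++ T] := by
  rw [subsamples, if_pos h]

theorem subsamples_of_lt_length {S : List α} (T : List α) (h : 3 < S.length) :
    subsamples S T =
      subsamples (S.take (S.length - 3 * (S.length / 4)))
        ((S.drop (S.length - 3 * (S.length / 4) + S.length / 4)).take (S.length / 4) ++
          S.drop (S.length - 3 * (S.length / 4) + 2 * (S.length / 4)) ++ T) ++
      subsamples (S.take (S.length - 3 * (S.length / 4)))
        ((S.drop (S.length - 3 * (S.length / 4))).take (S.length / 4) ++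
          S.drop (S.length - 3 * (S.length / 4) + 2 * (S.length / 4)) ++ T) ++
      subsamples (S.take (S.length - 3 * (S.length / 4)))
        ((S.drop (S.length - 3 * (S.length / 4))).take (S.length / 4) ++
          (S.drop (S.length - 3 * (S.length / 4) + S.length / 4)).take (S.length / 4) ++ T) := by
  conv_lhs => rw [subsamples]
  rw [if_neg (by omega)]

/-- A long list is the concatenation of the four blocks of the recursion for `subsamples`. -/
theorem exists_blocks {S : List α} (h : 3 < S.length) :
    ∃ S₀ S₁ S₂ S₃ : List α, S = S₀ ++ S₁ ++ S₂ ++ S₃ ∧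
      S₀.length = S.length - 3 * (S.length / 4) ∧ S₁.length = S.length / 4 ∧
      S₂.length = S.length / 4 ∧ S₃.length = S.length / 4 ∧
      ∀ T, subsamples S T = subsamples S₀ (S₂ ++ S₃ ++ T) ++ subsamples S₀ (S₁ ++ S₃ ++ T) ++
        subsamples S₀ (S₁ ++ S₂ ++ T) := by
  refine ⟨_, _, _, _, ?_, ?_, ?_, ?_, ?_, fun T => subsamples_of_lt_length T h⟩
  · have h2 : S.drop (S.length - 3 * (S.length / 4) + 2 * (S.length / 4))
        = (S.drop (S.length - 3 * (S.length / 4) + S.length / 4)).drop (S.length / 4) := by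
      rw [List.drop_drop]; congr 1; omega
    have h1 : S.drop (S.length - 3 * (S.length / 4) + S.length / 4)
        = (S.drop (S.length - 3 * (S.length / 4))).drop (S.length / 4) := by
      rw [List.drop_drop]
    rw [List.append_assoc, h2, List.take_append_drop, h1, List.append_assoc,
      List.take_append_drop, List.take_append_drop]
  all_goals simp only [List.length_take, List.length_drop]; omega

/-- The recursion looks only at lengths and positions. It can therefore be run on sample indices,
where avoiding a block has a meaning even if sample points coincide. -/
theorem subsamples_map (g : α → β) (S T : List α) :
    subsamples (S.map g) (T.map g) = (subsamples S T).map (List.map g) := by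
  induction hn : S.length using Nat.strong_induction_on generalizing S T with
  | _ n ih =>
    by_cases h : S.length ≤ 3
    · rw [subsamples_of_length_le _ (by simpa using h), subsamples_of_length_le _ h]
      simp
    · push Not at h
      rw [subsamples_of_lt_length _ (by simpa using h), subsamples_of_lt_length _ h]
      simp only [List.length_map, ← List.map_take, ← List.map_drop, ← List.map_append]
      have hlt : (S.take (S.length - 3 * (S.length / 4))).length < n := by
        rw [List.length_take]; omega
      rw [ih _ hlt _ _ rfl, ih _ hlt _ _ rfl, ih _ hlt _ _ rfl, List.map_append, List.map_append]

/-- The three recursive calls share S₀ and differ only in T, so this makes the three voting groups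
equally large. -/
theorem length_subsamples (S T T' : List α) :
    (subsamples S T).length = (subsamples S T').length := by
  induction hn : S.length using Nat.strong_induction_on generalizing S T T' with
  | _ n ih =>
    by_cases h : S.length ≤ 3
    · rw [subsamples_of_length_le _ h, subsamples_of_length_le _ h]
      simp
    · push Not at h
      obtain ⟨S₀, S₁, S₂, S₃, -, h0, -, -, -, hsub⟩ := exists_blocks h
      simp only [hsub, List.length_append]
      have hlt : S₀.length < n := by omega
      rw [ih _ hlt S₀ (S₂ ++ S₃ ++ T) [] rfl, ih _ hlt S₀ (S₁ ++ S₃ ++ T) [] rfl,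
        ih _ hlt S₀ (S₁ ++ S₂ ++ T) [] rfl, ih _ hlt S₀ (S₂ ++ S₃ ++ T') [] rfl,
        ih _ hlt S₀ (S₁ ++ S₃ ++ T') [] rfl, ih _ hlt S₀ (S₁ ++ S₂ ++ T') [] rfl]

theorem length_subsamples_pos (S T : List α) : 0 < (subsamples S T).length := by
  induction hn : S.length using Nat.strong_induction_on generalizing S T with
  | _ n ih =>
    by_cases h : S.length ≤ 3
    · rw [subsamples_of_length_le _ h]
      simp
    · push Not at h
      obtain ⟨S₀, S₁, S₂, S₃, -, h0, -, -, -, hsub⟩ := exists_blocks h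
      simp only [hsub, List.length_append]
      have := ih S₀.length (by omega) S₀ (S₂ ++ S₃ ++ T) rfl
      omega

/-- The second argument is only ever enlarged. Hence a block placed in it is used to train every
classifier of the group. -/
theorem subset_of_mem_subsamples {S T l : List α} (hl : l ∈ subsamples S T) : T ⊆ l := by
  induction hn : S.length using Nat.strong_induction_on generalizing S T with
  | _ n ih =>
    by_cases h : S.length ≤ 3
    · rw [subsamples_of_length_le _ h, List.mem_singleton] at hl
      subst hl
      exact List.subset_append_right _ _
    · push Not at h
      obtain ⟨S₀, S₁, S₂, S₃, -, h0, -, -, -, hsub⟩ := exists_blocks h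
      have hlt : S₀.length < n := by omega
      rw [hsub] at hl
      rcases List.mem_append.1 hl with hl | hl
      · rcases List.mem_append.1 hl with hl | hl
        all_goals exact fun x hx => ih _ hlt hl rfl (List.mem_append_right _ hx)
      · exact fun x hx => ih _ hlt hl rfl (List.mem_append_right _ hx)

theorem subperm_of_mem_subsamples {S T l : List α} (hl : l ∈ subsamples S T) :
    l.Subperm (S ++ T) := by
  induction hn : S.length using Nat.strong_induction_on generalizing S T with
  | _ n ih =>
    by_cases h : S.length ≤ 3
    · rw [subsamples_of_length_le _ h, List.mem_singleton] at hl
      exact hl ▸ List.Subperm.refl _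
    · push Not at h
      obtain ⟨S₀, S₁, S₂, S₃, hS, h0, -, -, -, hsub⟩ := exists_blocks h
      have hlt : S₀.length < n := by omega
      rw [hsub] at hl
      rw [hS]
      rcases List.mem_append.1 hl with hl | hl
      · rcases List.mem_append.1 hl with hl | hl
        · refine (ih _ hlt hl rfl).trans (List.Sublist.subperm ?_)
          simp only [List.append_assoc]
          exact (List.Sublist.refl _).append (List.sublist_append_right _ _)
        · refine (ih _ hlt hl rfl).trans (List.Sublist.subperm ?_)
          simp only [List.append_assoc]
          exact (List.Sublist.refl _).append ((List.Sublist.refl _).append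
            (List.sublist_append_right _ _))
      · refine (ih _ hlt hl rfl).trans (List.Sublist.subperm ?_)
        simp only [List.append_assoc]
        exact (List.Sublist.refl _).append ((List.Sublist.refl _).append
          ((List.Sublist.refl _).append (List.sublist_append_right _ _)))

end Subsamples

/-! ### Majority votes and their errors. -/

section Majority

variable {X : Type*} [MeasurableSpace X]

/-- The sum of the labels that the classifiers `hs` give to `t`. -/
def labelSum (hs : List (Classifier X)) (t : X) : ℤ :=
  ((hs.map (fun h => h.1 t)).map (fun y : ℤˣ => (y : ℤ))).sum

/-- The number of classifiers in `hs` that disagree with `f` at `t`. -/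
def errCount (hs : List (Classifier X)) (f : Classifier X) (t : X) : ℕ :=
  hs.countP fun h => h.1 t ≠ f.1 t

theorem labelSum_cons (h : Classifier X) (hs : List (Classifier X)) (t : X) :
    labelSum (h :: hs) t = (h.1 t : ℤ) + labelSum hs t := by
  simp [labelSum]

theorem labelSum_append (hs hs' : List (Classifier X)) (t : X) :
    labelSum (hs ++ hs') t = labelSum hs t + labelSum hs' t := by
  simp [labelSum]

theorem labelSum_eq (hs : List (Classifier X)) (f : Classifier X) (t : X) :
    labelSum hs t = (f.1 t : ℤ) * (hs.length - 2 * errCount hs f t) := by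
  induction hs with
  | nil => simp [labelSum, errCount]
  | cons h hs ih =>
    rw [labelSum_cons, ih]
    simp only [errCount, List.countP_cons, List.length_cons]
    rcases Int.units_eq_one_or (h.1 t) with h1 | h1 <;>
      rcases Int.units_eq_one_or (f.1 t) with h2 | h2 <;> simp [h1, h2] <;> ring

theorem maj_apply (hs : List (Classifier X)) (t : X) :
    (maj hs).1 t = if 0 ≤ labelSum hs t then 1 else -1 := rfl

theorem mem_errSet_maj {hs : List (Classifier X)} {f : Classifier X} {t : X} :
    t ∈ errSet (maj hs) f ↔
      (f.1 t = 1 ∧ labelSum hs t < 0) ∨ (f.1 t = -1 ∧ 0 ≤ labelSum hs t) := by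
  change (maj hs).1 t ≠ f.1 t ↔ _
  rw [maj_apply]
  rcases Int.units_eq_one_or (f.1 t) with h2 | h2 <;> split_ifs with h <;> simp [h2, h, not_le.1]

theorem errCount_le_length (hs : List (Classifier X)) (f : Classifier X) (t : X) :
    errCount hs f t ≤ hs.length :=
  List.countP_le_length

theorem measurable_errCount (hs : List (Classifier X)) (f : Classifier X) :
    Measurable fun t => (errCount hs f t : ℝ≥0∞) := by
  induction hs with
  | nil => simp [errCount]
  | cons h hs ih =>
    have : (fun t => (errCount (h :: hs) f t : ℝ≥0∞))
        = fun t => (errCount hs f t : ℝ≥0∞) + (errSet h f).indicator (fun _ => 1) t := by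
      ext t
      simp only [errCount, List.countP_cons]
      by_cases hh : h.1 t = f.1 t <;> simp [errSet, hh]
    rw [this]
    exact ih.add (measurable_const.indicator (measurableSet_errSet h f))

theorem setLIntegral_errCount_le {P : Measure X} {A : Set X}
    {hs : List (Classifier X)} {f : Classifier X} {η : ℝ≥0∞}
    (h : ∀ g ∈ hs, P (A ∩ errSet g f) ≤ η) :
    ∫⁻ t in A, errCount hs f t ∂P ≤ hs.length * η := by
  induction hs with
  | nil => simp [errCount]
  | cons g hs ih =>
    have : (fun t => (errCount (g :: hs) f t : ℝ≥0∞))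
        = fun t => (errCount hs f t : ℝ≥0∞) + (errSet g f).indicator (fun _ => 1) t := by
      ext t
      simp only [errCount, List.countP_cons]
      by_cases hh : g.1 t = f.1 t <;> simp [errSet, hh]
    rw [this, lintegral_add_left (measurable_errCount hs f),
      lintegral_indicator_const (measurableSet_errSet g f), one_mul,
      Measure.restrict_apply (measurableSet_errSet g f), Set.inter_comm, List.length_cons]
    push_cast
    rw [add_mul, one_mul]
    exact add_le_add (ih fun g' hg' => h g' (List.mem_cons_of_mem _ hg')) (h g List.mem_cons_self)

/-- Markov's inequality on A for twice the number of erring classifiers: its integral is at most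
2(Kη + Kη). -/
theorem length_mul_measure_le {P : Measure X} {A : Set X} {hs hs' : List (Classifier X)}
    {f : Classifier X} {η : ℝ≥0∞} {K : ℕ} (hK : hs.length = K) (hK' : hs'.length = K)
    (h : ∀ g ∈ hs, P (A ∩ errSet g f) ≤ η) (h' : ∀ g ∈ hs', P (A ∩ errSet g f) ≤ η) :
    K * P ({t | K ≤ 2 * (errCount hs f t + errCount hs' f t)} ∩ A) ≤ K * (4 * η) := by
  have hm : Measurable fun t => (errCount hs f t : ℝ≥0∞) + errCount hs' f t :=
    (measurable_errCount hs f).add (measurable_errCount hs' f)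
  have hset : {t | K ≤ 2 * (errCount hs f t + errCount hs' f t)}
      = {t | (K : ℝ≥0∞) ≤ 2 * ((errCount hs f t : ℝ≥0∞) + errCount hs' f t)} := by
    ext t
    simp only [Set.mem_ofPred_eq]
    norm_cast
  rw [hset, ← Measure.restrict_apply (measurableSet_le measurable_const (hm.const_mul 2))]
  refine (mul_meas_ge_le_lintegral (hm.const_mul 2) _).trans ?_
  rw [lintegral_const_mul _ hm]
  rw [lintegral_add_left (measurable_errCount hs f)]
  calc _ ≤ 2 * (hs.length * η + hs'.length * η) := by
        gcongr
        · exact setLIntegral_errCount_le h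
        · exact setLIntegral_errCount_le h'
    _ = K * (4 * η) := by rw [hK, hK']; ring

/-- If the majority of three groups of classifiers of equal size errs, then the majority of some
group errs, together with at least a quarter of the other two groups. -/
theorem measure_errSet_maj_append_le {P : Measure X} {hs₁ hs₂ hs₃ : List (Classifier X)}
    {f : Classifier X} {η : ℝ≥0∞} {K : ℕ} (hK : 0 < K)
    (h1 : hs₁.length = K) (h2 : hs₂.length = K) (h3 : hs₃.length = K)
    (h12 : ∀ g ∈ hs₂ ++ hs₃, P (errSet (maj hs₁) f ∩ errSet g f) ≤ η)
    (h21 : ∀ g ∈ hs₁ ++ hs₃, P (errSet (maj hs₂) f ∩ errSet g f) ≤ η)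
    (h31 : ∀ g ∈ hs₁ ++ hs₂, P (errSet (maj hs₃) f ∩ errSet g f) ≤ η) :
    P (errSet (maj (hs₁ ++ hs₂ ++ hs₃)) f) ≤ 12 * η := by
  have hK0 : (K : ℝ≥0∞) ≠ 0 := by exact_mod_cast hK.ne'
  have hKt : (K : ℝ≥0∞) ≠ ∞ := ENNReal.natCast_ne_top K
  set B : List (Classifier X) → List (Classifier X) → List (Classifier X) → Set X := fun a b c =>
    {t | K ≤ 2 * (errCount b f t + errCount c f t)} ∩ errSet (maj a) f with hB
  have hb : ∀ a b c, b.length = K → c.length = K →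
      (∀ g ∈ b ++ c, P (errSet (maj a) f ∩ errSet g f) ≤ η) → P (B a b c) ≤ 4 * η := by
    intro a b c hb hc h
    exact (ENNReal.mul_le_mul_iff_right hK0 hKt).1 (length_mul_measure_le hb hc
      (fun g hg => h g (List.mem_append_left _ hg)) fun g hg => h g (List.mem_append_right _ hg))
  -- With error counts e₁ + e₂ + e₃ ≥ 3K/2, strict when ties favour f, some group's majority errs.
  -- Since its own count is at most K, the other two counts sum to at least K/2.
  have hsub : errSet (maj (hs₁ ++ hs₂ ++ hs₃)) f
      ⊆ B hs₁ hs₂ hs₃ ∪ B hs₂ hs₁ hs₃ ∪ B hs₃ hs₁ hs₂ := by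
    intro t ht
    rw [mem_errSet_maj, labelSum_append, labelSum_append] at ht
    simp only [hB, Set.mem_union, Set.mem_inter_iff, Set.mem_ofPred_eq, mem_errSet_maj]
    rw [labelSum_eq hs₁ f, labelSum_eq hs₂ f, labelSum_eq hs₃ f] at ht ⊢
    have l1 := errCount_le_length hs₁ f t
    have l2 := errCount_le_length hs₂ f t
    have l3 := errCount_le_length hs₃ f t
    rw [h1] at l1 ⊢
    rw [h2] at l2 ⊢
    rw [h3] at l3 ⊢
    rw [h1, h2, h3] at ht
    rcases ht with ⟨hf, ht⟩ | ⟨hf, ht⟩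
    · simp only [hf, Units.val_one, one_mul, true_and] at ht ⊢
      omega
    · simp only [hf, Units.val_neg, Units.val_one, true_and] at ht ⊢
      omega
  calc P (errSet (maj (hs₁ ++ hs₂ ++ hs₃)) f)
      ≤ P (B hs₁ hs₂ hs₃ ∪ B hs₂ hs₁ hs₃ ∪ B hs₃ hs₁ hs₂) := measure_mono hsub
    _ ≤ P (B hs₁ hs₂ hs₃) + P (B hs₂ hs₁ hs₃) + P (B hs₃ hs₁ hs₂) :=
        (measure_union_le _ _).trans (add_le_add_left (measure_union_le _ _) _)
    _ ≤ 4 * η + 4 * η + 4 * η := by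
        gcongr
        · exact hb _ _ _ h2 h3 h12
        · exact hb _ _ _ h1 h3 h21
        · exact hb _ _ _ h1 h2 h31
    _ = 12 * η := by ring

/-- Only error events are assumed measurable. With labels ±1 they determine the predicted label as f
− 2f·1_err, so the vote sum is a.e. measurable. -/
theorem ErrNullMeasurable.maj {Ω : Type*} [MeasurableSpace Ω] {μ : Measure Ω} {P : Measure X}
    {f : Classifier X} {gs : List (Ω → Classifier X)}
    (h : ∀ g ∈ gs, ErrNullMeasurable μ P f g) :
    ErrNullMeasurable μ P f fun x => maj (gs.map fun g => g x) := by
  have hf : Measurable fun p : Ω × X => (f.1 p.2 : ℤ) :=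
    ((comap_measurable Units.val).comp f.2).comp measurable_snd
  have hsum : AEMeasurable (fun p : Ω × X => labelSum (gs.map fun g => g p.1) p.2) (μ.prod P) := by
    induction gs with
    | nil => simp [labelSum]
    | cons g gs ih =>
      have hg : AEMeasurable (fun p : Ω × X => ((g p.1).1 p.2 : ℤ)) (μ.prod P) := by
        have h1 : (fun p : Ω × X => ((g p.1).1 p.2 : ℤ)) = fun p => (f.1 p.2 : ℤ) -
            {p : Ω × X | (g p.1).1 p.2 ≠ f.1 p.2}.indicator (fun p => 2 * (f.1 p.2 : ℤ)) p := by
          ext p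
          rw [Set.indicator_apply]
          simp only [Set.mem_ofPred_eq]
          rcases Int.units_eq_one_or ((g p.1).1 p.2) with h1 | h1 <;>
            rcases Int.units_eq_one_or (f.1 p.2) with h2 | h2 <;> simp [h1, h2]
        rw [h1]
        exact hf.aemeasurable.sub ((hf.const_mul 2).aemeasurable.indicator₀ (h g List.mem_cons_self))
      simp only [List.map_cons, labelSum_cons]
      exact hg.add (ih fun g' hg' => h g' (List.mem_cons_of_mem _ hg'))
  have h0 : NullMeasurableSet {p : Ω × X | labelSum (gs.map fun g => g p.1) p.2 < 0} (μ.prod P) :=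
    nullMeasurableSet_lt hsum aemeasurable_const
  have h1 : MeasurableSet {p : Ω × X | (f.1 p.2 : ℤ) = 1} := hf (measurableSet_singleton 1)
  have heq : {p : Ω × X | (PACLearning.maj (gs.map fun g => g p.1)).1 p.2 ≠ f.1 p.2}
      = ({p : Ω × X | (f.1 p.2 : ℤ) = 1} ∩ {p | labelSum (gs.map fun g => g p.1) p.2 < 0}) ∪
        ({p : Ω × X | (f.1 p.2 : ℤ) = 1}ᶜ ∩ {p | labelSum (gs.map fun g => g p.1) p.2 < 0}ᶜ) := by
    ext p
    have := mem_errSet_maj (hs := gs.map fun g => g p.1) (f := f) (t := p.2)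
    simp only [errSet, Set.mem_ofPred_eq] at this
    simp only [Set.mem_ofPred_eq, this, Set.mem_union, Set.mem_inter_iff, Set.mem_compl_iff,
      not_lt]
    rcases Int.units_eq_one_or (f.1 p.2) with h2 | h2 <;> simp [h2]
  rw [ErrNullMeasurable, heq]
  exact (h1.nullMeasurableSet.inter h0).union (h1.compl.nullMeasurableSet.inter h0.compl)

end Majority

/-! ### Numerical estimates for the recursion. -/

/-- The error bound of the majority vote for VC dimension `d`, sample size `m`, confidence `δ`. -/
noncomputable def errBound (d m : ℕ) (δ : ℝ) : ℝ :=
  1800 / ((m : ℝ) + 1) * ((d : ℝ) + Real.log (18 / δ))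

theorem log_eighteen_div_pos {δ : ℝ} (h0 : 0 < δ) (h1 : δ < 1) : 0 < Real.log (18 / δ) :=
  Real.log_pos ((one_lt_div h0).2 (by linarith))

theorem one_lt_log_eighteen_div {δ : ℝ} (h0 : 0 < δ) (h1 : δ < 1) : 1 < Real.log (18 / δ) := by
  rw [Real.lt_log_iff_exp_lt (by positivity)]
  have : Real.exp 1 < 3 := by linarith [Real.exp_one_lt_d9]
  have : 18 ≤ 18 / δ := by rw [le_div_iff₀ h0]; nlinarith
  linarith

theorem errBound_nonneg (d m : ℕ) {δ : ℝ} (h0 : 0 < δ) (h1 : δ < 1) : 0 ≤ errBound d m δ := by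
  have := log_eighteen_div_pos h0 h1
  unfold errBound
  positivity

theorem lt_of_errBound_lt_one {d m : ℕ} {δ : ℝ} (h : errBound d m δ < 1) :
    1800 * ((d : ℝ) + Real.log (18 / δ)) < m + 1 := by
  have hm : (0 : ℝ) < m + 1 := by positivity
  rwa [errBound, div_mul_eq_mul_div, div_lt_one hm] at h

theorem exp_half_le_one_add {η : ℝ} (h0 : 0 ≤ η) (h1 : η ≤ 1) : Real.exp (η / 2) ≤ 1 + η := by
  have h := Real.one_sub_inv_le_log_of_pos (x := 1 + η) (by linarith)
  have h2 : η / 2 ≤ 1 - (1 + η)⁻¹ := by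
    have : 1 - (1 + η)⁻¹ = η / (1 + η) := by field_simp; ring
    rw [this]
    gcongr
    linarith
  exact (Real.le_log_iff_exp_le (by linarith)).1 (h2.trans h)

/-- The localized bound with τ = e⁻⁹ and η = `errBound d m δ / 12` fails with probability at most
δ/6. With Λ = log(18/δ), the left exponent is at most d + Λ + log 6 because 2·1800·e⁻⁹ ≤ 1, and
(1+η)^q contributes at least 18(d + Λ). -/
theorem errBound_recursion {d m q r : ℕ} {δ : ℝ} (hq : m ≤ 4 * q + 3) (hqr : q ≤ r) (h0 : 0 < δ)
    (h1 : δ < 1) (hb : errBound d m δ < 1) :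
    (1 + Real.exp (-9) * errBound d r (δ / 6)) ^ (2 * q)
      ≤ ((1 + errBound d m δ / 12) ^ q * Real.exp (-9) ^ d) * (δ / 6) := by
  have hlog6 : Real.log (18 / (δ / 6)) = Real.log (18 / δ) + Real.log 6 := by
    rw [← Real.log_mul (by positivity) (by norm_num)]
    congr 1
    field_simp
  have hlogδ : Real.log (6 / δ) ≤ Real.log (18 / δ) := by
    apply Real.log_le_log (by positivity)
    gcongr
    norm_num
  have h6 : Real.log 6 ≤ Real.log (18 / δ) := by
    apply Real.log_le_log (by positivity)
    rw [le_div_iff₀ h0]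
    linarith
  have hlogpos := one_lt_log_eighteen_div h0 h1
  have hm := lt_of_errBound_lt_one hb
  have hbr := errBound_nonneg d r (δ := δ / 6) (by positivity) (by linarith)
  have hbm := errBound_nonneg d m h0 h1
  set Λ := Real.log (18 / δ) with hΛ
  have hd : (0 : ℝ) ≤ d := by positivity
  have hexp9 : 3600 * Real.exp (-9) ≤ 1 := by
    rw [Real.exp_neg, ← div_eq_mul_inv, div_le_one (Real.exp_pos _)]
    have h9 : Real.exp 9 = Real.exp 1 ^ 9 := by rw [← Real.exp_nat_mul]; norm_num
    rw [h9]
    calc (3600 : ℝ) ≤ 2.7 ^ 9 := by norm_num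
      _ ≤ Real.exp 1 ^ 9 := by
        gcongr
        linarith [Real.exp_one_gt_d9]
  have hp : 2 * q * (Real.exp (-9) * errBound d r (δ / 6)) ≤ d + Λ + Real.log 6 := by
    have hqr' : (q : ℝ) / (r + 1) ≤ 1 := by
      rw [div_le_one (by positivity)]
      have : (q : ℝ) ≤ r := by exact_mod_cast hqr
      linarith
    have hl6 : 0 ≤ Real.log 6 := Real.log_nonneg (by norm_num)
    calc 2 * q * (Real.exp (-9) * errBound d r (δ / 6))
        = (3600 * Real.exp (-9)) * (q / (r + 1)) * (d + Λ + Real.log 6) := by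
          rw [errBound, hlog6]; ring
      _ ≤ 1 * 1 * (d + Λ + Real.log 6) := by gcongr
      _ = _ := by ring
  have hη : 18 * (d + Λ) ≤ q * (errBound d m δ / 12 / 2) := by
    have hqm : (m : ℝ) ≤ 4 * q + 3 := by exact_mod_cast hq
    -- Here 75 = 1800/(12·2). Since q is nearly m/4 the ratio is nearly 75/4, and m + 1 > 1800
    -- leaves room for rounding.
    have h75 : 18 ≤ 75 * q / ((m : ℝ) + 1) := by
      rw [le_div_iff₀ (by positivity)]
      linarith
    calc 18 * (d + Λ) ≤ 75 * q / ((m : ℝ) + 1) * (d + Λ) := by gcongr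
      _ = q * (errBound d m δ / 12 / 2) := by rw [errBound]; ring
  have hleft : (1 + Real.exp (-9) * errBound d r (δ / 6)) ^ (2 * q)
      ≤ Real.exp (d + Λ + Real.log 6) := by
    calc _ ≤ Real.exp (Real.exp (-9) * errBound d r (δ / 6)) ^ (2 * q) := by
          gcongr
          rw [add_comm]
          exact Real.add_one_le_exp _
      _ = Real.exp (2 * q * (Real.exp (-9) * errBound d r (δ / 6))) := by
          rw [← Real.exp_nat_mul]
          push_cast
          rfl
      _ ≤ _ := Real.exp_le_exp.2 hp
  have hright : Real.exp (18 * (d + Λ)) ≤ (1 + errBound d m δ / 12) ^ q := by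
    calc _ ≤ Real.exp (errBound d m δ / 12 / 2) ^ q := by
          rw [← Real.exp_nat_mul]
          exact Real.exp_le_exp.2 hη
      _ ≤ _ := by
          gcongr
          exact exp_half_le_one_add (by positivity) (by linarith)
  have hδ : δ / 6 = Real.exp (-Real.log (6 / δ)) := by
    rw [Real.exp_neg, Real.exp_log (by positivity), inv_div]
  calc _ ≤ Real.exp (d + Λ + Real.log 6) := hleft
    _ ≤ Real.exp (18 * (d + Λ)) * Real.exp (-9) ^ d * Real.exp (-Real.log (6 / δ)) := by
        rw [← Real.exp_nat_mul, ← Real.exp_add, ← Real.exp_add]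
        -- The exponents satisfy d + Λ + log 6 ≤ 18(d + Λ) − 9d − log(6/δ), because both log 6 and
        -- log(6/δ) are at most Λ.
        refine Real.exp_le_exp.2 ?_
        nlinarith
    _ ≤ _ := by rw [← hδ]; gcongr

/-! ### The induction over the recursive subsamples. -/

section Recursion

variable {ι X : Type*} [MeasurableSpace X]

/-- The classifier returned by `L` on the sample points with indices in `l`, labelled by `f`. -/
def trainedOn (L : Learner X) (f : Classifier X) (l : List ι) (x : ι → X) : Classifier X :=
  L (l.map fun i => (x i, f.1 (x i)))

/-- The majority vote over the recursive subsamples of the index lists `S` and `T`. -/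
def majOn (L : Learner X) (f : Classifier X) (S T : List ι) (x : ι → X) : Classifier X :=
  maj ((subsamples S T).map fun l => trainedOn L f l x)

variable {C : Set (Classifier X)} {L : Learner X} {f : Classifier X}

theorem trainedOn_mem_consistentSet (hL : IsConsistentLearner C L) (hf : f ∈ C) (l : List ι)
    (x : ι → X) :
    trainedOn L f l x ∈ consistentSet C (l.map fun i => (x i, f.1 (x i))) := by
  refine hL _ ⟨f, hf, fun z hz => ?_⟩
  obtain ⟨i, -, rfl⟩ := List.mem_map.1 hz
  rfl

theorem nodup_of_mem_subsamples {S T l : List ι} (h : (S ++ T).Nodup)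
    (hl : l ∈ subsamples S T) : l.Nodup := by
  obtain ⟨l', hp, hs⟩ := subperm_of_mem_subsamples hl
  exact hp.nodup_iff.1 (hs.nodup h)

theorem majOn_congr {S T : List ι} {x y : ι → X} (h : ∀ i ∈ S ++ T, x i = y i) :
    majOn L f S T x = majOn L f S T y := by
  have : ((subsamples S T).map fun l => trainedOn L f l x)
      = (subsamples S T).map fun l => trainedOn L f l y := by
    refine List.map_congr_left fun l hl => ?_
    have : (l.map fun i => (x i, f.1 (x i))) = l.map fun i => (y i, f.1 (y i)) :=
      List.map_congr_left fun i hi => by rw [h i ((subperm_of_mem_subsamples hl).subset hi)]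
    rw [trainedOn, this, trainedOn]
  rw [majOn, this, majOn]

variable [Fintype ι]

theorem errNullMeasurable_trainedOn (hM : HasMeasurableErrors C L) (hf : f ∈ C) (P : Measure X)
    [hP : IsProbabilityMeasure P] {l : List ι} (hl : l.Nodup) :
    ErrNullMeasurable (Measure.pi fun _ : ι => P) P f (trainedOn L f l) := by
  have h : ErrNullMeasurable (Measure.pi fun _ : Fin l.length => P) P f
      (fun x => L (label f x)) := hM P hP f hf l.length
  have h' := h.comp_measurePreserving
    (measurePreserving_comp_injective P (List.nodup_iff_injective_get.1 hl))
  have heq : trainedOn L f l = fun x : ι → X => L (label f fun k => x (l.get k)) := by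
    ext1 x
    rw [trainedOn, label]
    congr 1
    exact (List.ofFn_getElem_eq_map l fun i => (x i, f.1 (x i))).symm
  rw [heq]
  exact h'

theorem errNullMeasurable_majOn (hM : HasMeasurableErrors C L) (hf : f ∈ C) (P : Measure X)
    [IsProbabilityMeasure P] {S T : List ι} (h : (S ++ T).Nodup) :
    ErrNullMeasurable (Measure.pi fun _ : ι => P) P f (majOn L f S T) := by
  have := ErrNullMeasurable.maj (μ := Measure.pi fun _ : ι => P) (P := P) (f := f)
    (gs := (subsamples S T).map (trainedOn L f)) (by
      intro g hg
      obtain ⟨l, hl, rfl⟩ := List.mem_map.1 hg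
      exact errNullMeasurable_trainedOn hM hf P (nodup_of_mem_subsamples h hl))
  simp only [List.map_map, Function.comp_def] at this
  exact this

/-- Classifiers trained on a data set that contains the block `J` are unlikely to share many errors
with the majority vote over subsamples that avoid `J`. -/
theorem measure_exists_common_errors_le {P : Measure X} [IsProbabilityMeasure P] {d m : ℕ}
    (hd : vcDim C ≤ d) (hL : IsConsistentLearner C L) (hM : HasMeasurableErrors C L) (hf : f ∈ C)
    {S T J : List ι} {others : List (List ι)} (hJ : J.Nodup) (hST : (S ++ T).Nodup)
    (hdisj : (S ++ T).Disjoint J) (hothers : ∀ l ∈ others, l.Nodup ∧ J ⊆ l)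
    (hm : m ≤ 4 * J.length + 3) (hS : J.length ≤ S.length) {δ : ℝ} (h0 : 0 < δ) (h1 : δ < 1)
    (hb : errBound d m δ < 1) :
    (Measure.pi fun _ => P) {x | P (errSet (majOn L f S T x) f)
        ≤ ENNReal.ofReal (errBound d S.length (δ / 6)) ∧
      ∃ l ∈ others, ENNReal.ofReal (errBound d m δ / 12)
        < P (errSet (majOn L f S T x) f ∩ errSet (trainedOn L f l x) f)}
      ≤ ENNReal.ofReal (δ / 6) := by
  classical
  have hmain := measure_exists_lt_measure_errSet_inter_le (P := P) (f := f) hd J.toFinset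
    (g := majOn L f S T) (H := fun (k : Fin others.length) => trainedOn L f (others.get k))
    (fun x y h => majOn_congr fun i hi => h i fun hiJ => hdisj hi (List.mem_toFinset.1 hiJ))
    (errNullMeasurable_majOn hM hf P hST)
    (fun k x => (trainedOn_mem_consistentSet hL hf _ x).1)
    (fun k x i hi => (trainedOn_mem_consistentSet hL hf _ x).2 (x i, f.1 (x i))
      (List.mem_map.2 ⟨i, (hothers _ (List.get_mem _ k)).2 (List.mem_toFinset.1 hi), rfl⟩))
    (fun k => errNullMeasurable_trainedOn hM hf P (hothers _ (List.get_mem _ k)).1)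
    -- A constant τ suffices: it costs only 9d in the exponent, yet is small enough to absorb the
    -- factor 3600 in 2q times the inductive bound.
    (τ := ENNReal.ofReal (Real.exp (-9)))
    (ENNReal.ofReal_le_one.2 (Real.exp_le_one_iff.2 (by norm_num)))
    (ENNReal.ofReal (errBound d S.length (δ / 6))) (ENNReal.ofReal (errBound d m δ / 12))
  rw [List.toFinset_card_of_nodup hJ] at hmain
  have hbm := errBound_nonneg d m h0 h1
  have hbr := errBound_nonneg d S.length (δ := δ / 6) (by positivity) (by linarith)
  have hnum := ENNReal.ofReal_le_ofReal (errBound_recursion hm hS h0 h1 hb)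
  have hK : (1 + ENNReal.ofReal (errBound d m δ / 12)) ^ J.length
      * ENNReal.ofReal (Real.exp (-9)) ^ d
      = ENNReal.ofReal ((1 + errBound d m δ / 12) ^ J.length * Real.exp (-9) ^ d) := by
    rw [ENNReal.ofReal_mul (by positivity), ENNReal.ofReal_pow (by positivity),
      ENNReal.ofReal_pow (by positivity), ENNReal.ofReal_add (by norm_num) (by positivity),
      ENNReal.ofReal_one]
  have hR : (1 + ENNReal.ofReal (Real.exp (-9))
      * ENNReal.ofReal (errBound d S.length (δ / 6))) ^ (2 * J.length)
      = ENNReal.ofReal ((1 + Real.exp (-9) * errBound d S.length (δ / 6)) ^ (2 * J.length)) := by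
    rw [ENNReal.ofReal_pow (by positivity), ENNReal.ofReal_add (by norm_num) (by positivity),
      ENNReal.ofReal_one, ENNReal.ofReal_mul (by positivity)]
  rw [hK, hR] at hmain
  rw [ENNReal.ofReal_mul (by positivity)] at hnum
  have hpos : 0 < (1 + errBound d m δ / 12) ^ J.length * Real.exp (-9) ^ d := by positivity
  have hfin := (ENNReal.mul_le_mul_iff_right (ENNReal.ofReal_pos.2 hpos).ne'
    ENNReal.ofReal_ne_top).1 (hmain.trans hnum)
  refine (measure_mono ?_).trans hfin
  rintro x ⟨hx, l, hl, hlt⟩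
  obtain ⟨k, rfl⟩ := List.get_of_mem hl
  exact ⟨hx, k, hlt⟩

/-- Strong induction on |S| with T and δ free, since each level moves blocks into T and divides δ by
six. The bound ignores T, and distinct indices make all blocks independent. -/
theorem measure_errBound_lt_le {P : Measure X} [IsProbabilityMeasure P] {d : ℕ}
    (hd : vcDim C ≤ d) (hL : IsConsistentLearner C L) (hM : HasMeasurableErrors C L) (hf : f ∈ C)
    {S T : List ι} (hST : (S ++ T).Nodup) {δ : ℝ} (h0 : 0 < δ) (h1 : δ < 1) :
    (Measure.pi fun _ => P) {x | ENNReal.ofReal (errBound d S.length δ)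
      < P (errSet (majOn L f S T x) f)} ≤ ENNReal.ofReal δ := by
  induction hn : S.length using Nat.strong_induction_on generalizing S T δ with
  | _ n ih =>
  subst hn
  -- A bound of at least 1 is vacuous. This covers |S| ≤ 3, so the base case of the algorithm needs
  -- no argument of its own.
  by_cases hb : 1 ≤ errBound d S.length δ
  · have : {x : ι → X | ENNReal.ofReal (errBound d S.length δ)
        < P (errSet (majOn L f S T x) f)} = ∅ := by
      refine Set.eq_empty_of_forall_notMem fun x hx => ?_
      exact absurd (hx.trans_le prob_le_one) (not_lt.2 (ENNReal.one_le_ofReal.2 hb))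
    rw [this]
    simp
  push Not at hb
  have hlen : 3 < S.length := by
    have hm := lt_of_errBound_lt_one hb
    have := one_lt_log_eighteen_div h0 h1
    have hd0 : (0 : ℝ) ≤ d := by positivity
    have : (3 : ℝ) < S.length := by linarith
    exact_mod_cast this
  obtain ⟨S₀, S₁, S₂, S₃, hS, l0, l1, l2, l3, hsub⟩ := exists_blocks hlen
  have hnd : (S₀ ++ (S₁ ++ (S₂ ++ (S₃ ++ T)))).Nodup := by
    rw [hS] at hST
    simpa only [List.append_assoc] using hST
  have n1 : (S₀ ++ (S₂ ++ S₃ ++ T)).Nodup := by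
    refine hnd.sublist ?_
    rw [List.append_assoc]
    exact (List.Sublist.refl _).append (List.sublist_append_right _ _)
  have n2 : (S₀ ++ (S₁ ++ S₃ ++ T)).Nodup := by
    refine hnd.sublist ?_
    rw [List.append_assoc]
    exact (List.Sublist.refl _).append ((List.Sublist.refl _).append
      (List.sublist_append_right _ _))
  have n3 : (S₀ ++ (S₁ ++ S₂ ++ T)).Nodup := by
    refine hnd.sublist ?_
    rw [List.append_assoc]
    exact (List.Sublist.refl _).append ((List.Sublist.refl _).append
      ((List.Sublist.refl _).append (List.sublist_append_right _ _)))
  have hlt : S₀.length < S.length := by omega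
  have δ0 : 0 < δ / 6 := by positivity
  have δ1 : δ / 6 < 1 := by linarith
  simp only [List.nodup_append', List.disjoint_append_right] at hnd
  set T₁ := S₂ ++ S₃ ++ T with hT₁
  set T₂ := S₁ ++ S₃ ++ T with hT₂
  set T₃ := S₁ ++ S₂ ++ T with hT₃
  set A : List ι → Set (ι → X) := fun T' => {x | ENNReal.ofReal (errBound d S₀.length (δ / 6))
      < P (errSet (majOn L f S₀ T' x) f)} with hA
  set B : List ι → List (List ι) → Set (ι → X) := fun T' others =>
    {x | P (errSet (majOn L f S₀ T' x) f) ≤ ENNReal.ofReal (errBound d S₀.length (δ / 6)) ∧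
      ∃ l ∈ others, ENNReal.ofReal (errBound d S.length δ / 12)
        < P (errSet (majOn L f S₀ T' x) f ∩ errSet (trainedOn L f l x) f)} with hB
  have hA1 : (Measure.pi fun _ => P) (A T₁) ≤ ENNReal.ofReal (δ / 6) := ih _ hlt n1 δ0 δ1 rfl
  have hA2 : (Measure.pi fun _ => P) (A T₂) ≤ ENNReal.ofReal (δ / 6) := ih _ hlt n2 δ0 δ1 rfl
  have hA3 : (Measure.pi fun _ => P) (A T₃) ≤ ENNReal.ofReal (δ / 6) := ih _ hlt n3 δ0 δ1 rfl
  have hoth : ∀ {T' T'' J : List ι}, (S₀ ++ T').Nodup → (S₀ ++ T'').Nodup → J ⊆ T' → J ⊆ T'' →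
      ∀ l ∈ subsamples S₀ T' ++ subsamples S₀ T'', l.Nodup ∧ J ⊆ l := by
    intro T' T'' J h' h'' hJ' hJ'' l hl
    rcases List.mem_append.1 hl with hl | hl
    · exact ⟨nodup_of_mem_subsamples h' hl, fun i hi => subset_of_mem_subsamples hl (hJ' hi)⟩
    · exact ⟨nodup_of_mem_subsamples h'' hl, fun i hi => subset_of_mem_subsamples hl (hJ'' hi)⟩
  have hB1 : (Measure.pi fun _ => P) (B T₁ (subsamples S₀ T₂ ++ subsamples S₀ T₃))
      ≤ ENNReal.ofReal (δ / 6) := by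
    -- S₁ is the block missing from S₀ and T₁ but contained in T₂ and T₃: fresh data for the first
    -- majority, training data for the other two groups.
    refine measure_exists_common_errors_le (J := S₁) hd hL hM hf (by tauto) n1 ?_
      (hoth n2 n3 ?_ ?_) (by omega) (by omega) h0 h1 hb
    · simp only [hT₁, List.disjoint_append_left]
      have := fun {l l' : List ι} (h : l.Disjoint l') => h.symm
      tauto
    · simp [hT₂]
    · simp [hT₃]
  have hB2 : (Measure.pi fun _ => P) (B T₂ (subsamples S₀ T₁ ++ subsamples S₀ T₃))
      ≤ ENNReal.ofReal (δ / 6) := by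
    refine measure_exists_common_errors_le (J := S₂) hd hL hM hf (by tauto) n2 ?_
      (hoth n1 n3 ?_ ?_) (by omega) (by omega) h0 h1 hb
    · simp only [hT₂, List.disjoint_append_left]
      have := fun {l l' : List ι} (h : l.Disjoint l') => h.symm
      tauto
    · simp [hT₁]
    · simp [hT₃]
  have hB3 : (Measure.pi fun _ => P) (B T₃ (subsamples S₀ T₁ ++ subsamples S₀ T₂))
      ≤ ENNReal.ofReal (δ / 6) := by
    refine measure_exists_common_errors_le (J := S₃) hd hL hM hf (by tauto) n3 ?_
      (hoth n1 n2 ?_ ?_) (by omega) (by omega) h0 h1 hb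
    · simp only [hT₃, List.disjoint_append_left]
      have := fun {l l' : List ι} (h : l.Disjoint l') => h.symm
      tauto
    · simp [hT₁]
    · simp [hT₂]
  have hcover : {x | ENNReal.ofReal (errBound d S.length δ) < P (errSet (majOn L f S T x) f)}
      ⊆ A T₁ ∪ A T₂ ∪ A T₃ ∪ B T₁ (subsamples S₀ T₂ ++ subsamples S₀ T₃)
        ∪ B T₂ (subsamples S₀ T₁ ++ subsamples S₀ T₃)
        ∪ B T₃ (subsamples S₀ T₁ ++ subsamples S₀ T₂) := by
    intro x hx
    by_contra hnot
    simp only [hA, hB, Set.mem_union, Set.mem_ofPred_eq, not_or, not_and, not_exists,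
      not_lt] at hnot
    obtain ⟨⟨⟨⟨⟨a1, a2⟩, a3⟩, b1⟩, b2⟩, b3⟩ := hnot
    rw [Set.mem_ofPred_eq] at hx
    refine absurd hx (not_lt.2 ?_)
    have h12 : ENNReal.ofReal (errBound d S.length δ)
        = 12 * ENNReal.ofReal (errBound d S.length δ / 12) := by
      rw [← ENNReal.ofReal_ofNat, ← ENNReal.ofReal_mul (by norm_num)]
      congr 1
      ring
    rw [h12, majOn, hsub, List.map_append, List.map_append]
    refine measure_errSet_maj_append_le (length_subsamples_pos S₀ T₁) ?_ ?_ ?_ ?_ ?_ ?_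
    · rw [List.length_map]
    · rw [List.length_map, length_subsamples S₀ _ T₁]
    · rw [List.length_map, length_subsamples S₀ _ T₁]
    · rw [← List.map_append]
      intro g hg
      obtain ⟨l, hl, rfl⟩ := List.mem_map.1 hg
      exact b1 a1 l hl
    · rw [← List.map_append]
      intro g hg
      obtain ⟨l, hl, rfl⟩ := List.mem_map.1 hg
      exact b2 a2 l hl
    · rw [← List.map_append]
      intro g hg
      obtain ⟨l, hl, rfl⟩ := List.mem_map.1 hg
      exact b3 a3 l hl
  refine (measure_mono hcover).trans ?_
  have hsum : ENNReal.ofReal δ = ENNReal.ofReal (δ / 6) + ENNReal.ofReal (δ / 6)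
      + ENNReal.ofReal (δ / 6) + ENNReal.ofReal (δ / 6) + ENNReal.ofReal (δ / 6)
      + ENNReal.ofReal (δ / 6) := by
    iterate 5 rw [← ENNReal.ofReal_add (by positivity) (by positivity)]
    congr 1
    ring
  rw [hsum]
  refine (measure_union_le _ _).trans (add_le_add ?_ hB3)
  refine (measure_union_le _ _).trans (add_le_add ?_ hB2)
  refine (measure_union_le _ _).trans (add_le_add ?_ hB1)
  refine (measure_union_le _ _).trans (add_le_add ?_ hA3)
  exact (measure_union_le _ _).trans (add_le_add hA1 hA2)

end Recursion

/-! ### Back to data sets, sample complexity and the final constants. -/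

section PAC

variable {X : Type*} [MeasurableSpace X] {C : Set (Classifier X)} {L : Learner X}

theorem majLearner_label (f : Classifier X) {m : ℕ} (x : Fin m → X) :
    majLearner L (label f x) = majOn L f (List.finRange m) [] x := by
  have h : label f x = (List.finRange m).map fun i => (x i, f.1 (x i)) := List.ofFn_eq_map
  have h2 := subsamples_map (fun i => (x i, f.1 (x i))) (List.finRange m) []
  rw [List.map_nil] at h2
  rw [majLearner, majOn, h, h2, List.map_map]
  rfl

theorem nullMeasurableSet_er_majLearner_le (hM : HasMeasurableErrors C L) (P : Measure X)
    [IsProbabilityMeasure P] {f : Classifier X} (hf : f ∈ C) (m : ℕ) (ε : ℝ) :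
    NullMeasurableSet {x : Fin m → X | er P (majLearner L (label f x)) f ≤ ε} (iid P m) := by
  simp only [majLearner_label]
  have h := (errNullMeasurable_majOn hM hf P (S := List.finRange m) (T := [])
    (by simpa using List.nodup_finRange m)).aemeasurable_measure_errSet
  exact nullMeasurableSet_le h.ennreal_toReal aemeasurable_const

theorem isPAC_majLearner_errBound {d : ℕ} (hd : vcDim C ≤ d) (hL : IsConsistentLearner C L)
    (hM : HasMeasurableErrors C L) (m : ℕ) {δ : ℝ} (h0 : 0 < δ) (h1 : δ < 1) :
    IsPAC C (majLearner L) m (errBound d m δ) δ := by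
  intro P hP f hf
  have hnull := nullMeasurableSet_er_majLearner_le hM P hf m (errBound d m δ)
  refine ⟨hnull, ?_⟩
  have hP' : IsProbabilityMeasure (iid P m) := by unfold iid; infer_instance
  have hbad := measure_errBound_lt_le (P := P) hd hL hM hf (S := List.finRange m) (T := [])
    (by simpa using List.nodup_finRange m) h0 h1
  rw [List.length_finRange] at hbad
  have hcompl : {x : Fin m → X | er P (majLearner L (label f x)) f ≤ errBound d m δ}ᶜ
      ⊆ {x | ENNReal.ofReal (errBound d m δ)
        < P (errSet (majOn L f (List.finRange m) [] x) f)} := by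
    intro x hx
    simp only [Set.mem_compl_iff, Set.mem_ofPred_eq, not_le, majLearner_label] at hx
    exact (ENNReal.ofReal_lt_iff_lt_toReal (errBound_nonneg d m h0 h1) (measure_ne_top _ _)).2 hx
  have h := probReal_compl_eq_one_sub₀ hnull
  have hle : (iid P m).real {x : Fin m → X |
      er P (majLearner L (label f x)) f ≤ errBound d m δ}ᶜ ≤ δ :=
    ENNReal.toReal_le_of_le_ofReal h0.le ((measure_mono hcompl).trans hbad)
  linarith

/-- The probability is monotone in ε, but measurability of the larger event is a separate matter,
supplied here by the convention on `L`. -/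
theorem isPAC_majLearner_mono (hM : HasMeasurableErrors C L) {m : ℕ} {ε ε' δ : ℝ}
    (h : IsPAC C (majLearner L) m ε δ) (hε : ε ≤ ε') : IsPAC C (majLearner L) m ε' δ := by
  intro P hP f hf
  have hP' : IsProbabilityMeasure (iid P m) := by unfold iid; infer_instance
  refine ⟨nullMeasurableSet_er_majLearner_le hM P hf m ε', (h P hP f hf).2.trans ?_⟩
  exact measureReal_mono fun x (hx : _ ≤ ε) => hx.trans hε

theorem one_le_Log (z : ℝ) : 1 ≤ Log z := by
  rw [Log, Real.le_log_iff_exp_le (lt_max_of_lt_right (Real.exp_pos 1))]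
  exact le_max_right _ _

/-- Since log 18 ≤ 3 and Log ≥ 1, d + log(18/δ) ≤ 4(d + Log(1/δ)), and 7200 = 4·1800. -/
theorem errBound_le_of_le {d m : ℕ} {ε δ : ℝ} (hε : 0 < ε) (h0 : 0 < δ)
    (hm : 7200 * ((1 / ε) * ((d : ℝ) + Log (1 / δ))) ≤ m) : errBound d m δ ≤ ε := by
  have hLog := one_le_Log (1 / δ)
  have h18 : Real.log 18 ≤ 3 := by
    rw [Real.log_le_iff_le_exp (by norm_num)]
    have h3 : Real.exp 3 = Real.exp 1 ^ 3 := by rw [← Real.exp_nat_mul]; norm_num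
    rw [h3]
    calc (18 : ℝ) ≤ 2.7 ^ 3 := by norm_num
      _ ≤ Real.exp 1 ^ 3 := by
        gcongr
        linarith [Real.exp_one_gt_d9]
  have hle : Real.log (1 / δ) ≤ Log (1 / δ) := Real.log_le_log (by positivity) (le_max_left _ _)
  have hsplit : Real.log (18 / δ) = Real.log 18 + Real.log (1 / δ) := by
    rw [← Real.log_mul (by norm_num) (by positivity)]
    congr 1
    ring
  have hd : (0 : ℝ) ≤ d := by positivity
  have hb : (d : ℝ) + Real.log (18 / δ) ≤ 4 * (d + Log (1 / δ)) := by linarith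
  have hm' : 7200 * ((d : ℝ) + Log (1 / δ)) ≤ m * ε := by
    have := mul_le_mul_of_nonneg_right hm hε.le
    calc _ = 7200 * ((1 / ε) * ((d : ℝ) + Log (1 / δ))) * ε := by field_simp
      _ ≤ _ := this
  rw [errBound, div_mul_eq_mul_div, div_le_iff₀ (by positivity)]
  nlinarith

theorem exists_sampleComplexity_eq {A : Learner X} {m : ℕ} {ε δ : ℝ} (h : IsPAC C A m ε δ) :
    ∃ M : ℕ, sampleComplexity C ε δ = M ∧ M ≤ m := by
  have hle : sampleComplexity C ε δ ≤ m := sInf_le ⟨m, rfl, A, h⟩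
  obtain ⟨M, hM⟩ := ENat.ne_top_iff_exists.1 (ne_top_of_le_ne_top (ENat.natCast_ne_top m) hle)
  refine ⟨M, hM.symm, ?_⟩
  rw [← hM] at hle
  exact_mod_cast hle

end PAC

end PACLearning

open PACLearning
theorem theorem1 :
    ∃ c₀ : ℝ, 0 < c₀ ∧
      ∀ (X : Type*) [MeasurableSpace X] (C : Set (Classifier X)) (d : ℕ) (L : Learner X),
        3 ≤ C.encard →
        vcDim C = (d : ℕ∞) →
        IsConsistentLearner C L →
        HasMeasurableErrors C L →
        -- the sample complexity of `C`
        (∀ ε δ : ℝ, 0 < ε → ε < 1 → 0 < δ → δ < 1 →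
          ∃ M : ℕ, sampleComplexity C ε δ = (M : ℕ∞) ∧
            (M : ℝ) ≤ c₀ * ((1 / ε) * ((d : ℝ) + Log (1 / δ)))) ∧
        -- it is achieved by the majority vote over the recursive subsamples
        (∀ ε δ : ℝ, 0 < ε → ε < 1 → 0 < δ → δ < 1 →
          ∀ m : ℕ, c₀ * ((1 / ε) * ((d : ℝ) + Log (1 / δ))) ≤ (m : ℝ) →
            IsPAC C (majLearner L) m ε δ) ∧
        -- the explicit error bound of the majority vote
        (∀ (m : ℕ) (δ : ℝ), 0 < δ → δ < 1 →
          IsPAC C (majLearner L) m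
            (1800 / ((m : ℝ) + 1) * ((d : ℝ) + Real.log (18 / δ))) δ) := by
  -- 7200 is what the majority vote needs. The extra 1 pays for rounding the sample size up, as (d +
  -- Log(1/δ))/ε ≥ 1.
  refine ⟨7201, by norm_num, ?_⟩
  intro X _ C d L _ hd hL hM
  have hachieve : ∀ ε δ : ℝ, 0 < ε → 0 < δ → δ < 1 → ∀ m : ℕ,
      7200 * ((1 / ε) * ((d : ℝ) + Log (1 / δ))) ≤ (m : ℝ) → IsPAC C (majLearner L) m ε δ :=
    fun ε δ hε h0 h1 m hm => isPAC_majLearner_mono hM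
      (isPAC_majLearner_errBound hd.le hL hM m h0 h1) (errBound_le_of_le hε h0 hm)
  have hpos : ∀ ε δ : ℝ, 0 < ε → ε < 1 → 1 ≤ (1 / ε) * ((d : ℝ) + Log (1 / δ)) := by
    intro ε δ hε hε1
    have h1 : 1 ≤ 1 / ε := (one_le_div hε).2 hε1.le
    have h2 := one_le_Log (1 / δ)
    have hd0 : (0 : ℝ) ≤ d := by positivity
    exact one_le_mul_of_one_le_of_one_le h1 (by linarith)
  refine ⟨fun ε δ hε hε1 h0 h1 => ?_, fun ε δ hε hε1 h0 h1 m hm => ?_, fun m δ h0 h1 => ?_⟩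
  · have hp := hpos ε δ hε hε1
    obtain ⟨M, hM', hle⟩ := exists_sampleComplexity_eq (hachieve ε δ hε h0 h1 _ (Nat.le_ceil _))
    refine ⟨M, hM', ?_⟩
    have hceil := Nat.ceil_lt_add_one
      (show 0 ≤ 7200 * ((1 / ε) * ((d : ℝ) + Log (1 / δ))) by linarith)
    have : (M : ℝ) ≤ (⌈7200 * ((1 / ε) * ((d : ℝ) + Log (1 / δ)))⌉₊ : ℝ) := by exact_mod_cast hle
    linarith
  · exact hachieve ε δ hε h0 h1 m (by linarith [hpos ε δ hε hε1])
  · exact isPAC_majLearner_errBound hd.le hL hM m h0 h1
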